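/- Let $\mathcal K=(\mathcal K,\prec)$ be an abstract elementary class (AEC) with the joint embedding and amalgamation properties, let $\mu\ge \mathrm{LS}(\mathcal K)$ be a cardinal, and assume that $\mathcal K$ has no maximal model of cardinality $\mu^+$. Write $\mathcal K_\lambda$ for the class of models of cardinality $\lambda$ and $\operatorname{ga-S}(M)$ for the set of Galois types over $M$ (of single elements in strong extensions of $M$). We use the following notions. - $M$ is *universal over* $N\prec M$ if every $N'\in\mathcal K_{\|N\|}$ with $N\prec N'$ admits a $\mathcal K$-embedding into $M$ over $N$. - $M$ is a *limit model of cardinality $\lambda$* if, for some limit ordinal $\delta<\lambda^+$, $M=\bigcup_{i<\delta}M_i$ for an increasing continuous sequence $\langle M_i\in\mathcal K_\lambda\mid i<\delta\rangle$ with $M_{i+1}$ universal over $M_i$ for all $i<\delta$. - $p\in\operatorname{ga-S}(M)$ *$\lambda$-splits over* $N\prec M$ if there are $N_1,N_2\in\mathcal K_\lambda$ with $N\prec N_1,N_2\prec M$ and an isomorphism $h:N_1\cong N_2$ fixing $N$ pointwise such that $h(p\restriction N_1)\ne p\restriction N_2$. - $\mathcal K$ is *$\lambda$-superstable* if $|\operatorname{ga-S}(M)|\le\lambda$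 for all $M\in\mathcal K_\lambda$ and, for every infinite ordinal $\alpha$, every increasing sequence $\langle M_i\mid i<\alpha\rangle$ of limit models of cardinality $\lambda$ with $M_{i+1}$ universal over $M_i$ (whenever $i+1<\alpha$), and every $p\in\operatorname{ga-S}(\bigcup_{i<\alpha}M_i)$, there is $i<\alpha$ such that $p$ does not $\lambda$-split over $M_i$. - $M$ is *$\lambda$-saturated* if for every $N\prec M$ with $\|N\|<\lambda$, every $p\in\operatorname{ga-S}(N)$ is realized in $M$. Suppose that $\mathcal K$ is $\mu$-superstable and $\mu^+$-superstable and that any two limit models of cardinality $\mu^+$ are isomorphic. Let $\theta>0$ be an ordinal and let $\langle M_i\mid i<\theta\rangle$ be a $\prec$-increasing (not necessarily continuous) sequence of $\mu^+$-saturated models of cardinality at least $\mu^+$, where $\theta<(\sup_{i<\theta}\|M_i\|)^+$. Then $\bigcup_{i<\theta}M_i$ is a $\mu^+$-saturated model in $\mathcal K$. -/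

import Mathlib

open FirstOrder Cardinal

universe u

/-- An abstract elementary class in the language `L`: a class `Mem` of `L`-structures together with
a relation `Strong` of strong substructure (`Strong S`, for `S` a substructure of `N`, is read
`S ≺ N`), satisfying the axioms below. The union of a chain of structures is presented as a
structure `M` that is exhausted by a chain of its substructures. -/
structure AEC (L : FirstOrder.Language.{u, u}) where
  Mem : ∀ (M : Type u) [L.Structure M], Prop
  Strong : ∀ {N : Type u} [L.Structure N], L.Substructure N → Prop
  /-- `≺` is a relation between members of the class. -/
  mem_of_strong : ∀ {N : Type u} [L.Structure N] {S : L.Substructure N},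
    Strong S → Mem S ∧ Mem N
  /-- Closure under isomorphism. -/
  mem_equiv : ∀ {M N : Type u} [L.Structure M] [L.Structure N], (M ≃[L] N) → Mem M → Mem N
  strong_equiv : ∀ {M N : Type u} [L.Structure M] [L.Structure N] (e : M ≃[L] N)
    {S : L.Substructure M}, Strong S → Strong (S.map e.toHom)
  /-- `≺` is reflexive and transitive. -/
  strong_top : ∀ {M : Type u} [L.Structure M], Mem M → Strong (⊤ : L.Substructure M)
  strong_trans : ∀ {M : Type u} [L.Structure M] {S : L.Substructure M} {T : L.Substructure S},
    Strong S → Strong T → Strong (T.map S.subtype.toHom)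
  /-- Coherence: if `S ⊆ T ⊆ M`, `S ≺ M` and `T ≺ M`, then `S ≺ T`. -/
  coherence : ∀ {M : Type u} [L.Structure M] {S T : L.Substructure M},
    S ≤ T → Strong S → Strong T → Strong (S.comap T.subtype.toHom)
  /-- Tarski–Vaught: the union of an increasing chain of models is a model, and it is a strong
  extension of every member of the chain. -/
  union_chain : ∀ {M : Type u} [L.Structure M] (δ : Ordinal.{u}), Order.IsSuccLimit δ →
    ∀ S : Ordinal.{u} → L.Substructure M,
      (∀ i j, i ≤ j → j < δ → S i ≤ S j ∧ Strong ((S i).comap (S j).subtype.toHom)) →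
      (∀ x : M, ∃ i < δ, x ∈ S i) → Mem M ∧ ∀ i < δ, Strong (S i)
  /-- Tarski–Vaught: if all members of an increasing chain are strong in `M`, so is the union. -/
  union_strong : ∀ {M : Type u} [L.Structure M] (δ : Ordinal.{u}), Order.IsSuccLimit δ →
    ∀ (S : Ordinal.{u} → L.Substructure M) (U : L.Substructure M),
      (∀ i j, i ≤ j → j < δ → S i ≤ S j) → (∀ i < δ, Strong (S i)) →
      (∀ x : M, x ∈ U ↔ ∃ i < δ, x ∈ S i) → Strong U
  /-- Downward Löwenheim–Skolem. -/
  exists_LS : ∃ κ : Cardinal.{u}, ℵ₀ ≤ κ ∧ L.card ≤ κ ∧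
    ∀ (M : Type u) [L.Structure M], Mem M → ∀ A : Set M,
      ∃ S : L.Substructure M, Strong S ∧ A ⊆ S ∧ #S ≤ #A + κ

namespace AEC

variable {L : FirstOrder.Language.{u, u}} (K : AEC L)

/-- The Löwenheim–Skolem number: the least infinite cardinal `κ ≥ |L|` for which the downward
Löwenheim–Skolem property holds. -/
noncomputable def LS : Cardinal.{u} :=
  sInf {κ | ℵ₀ ≤ κ ∧ L.card ≤ κ ∧
    ∀ (M : Type u) [L.Structure M], K.Mem M → ∀ A : Set M,
      ∃ S : L.Substructure M, K.Strong S ∧ A ⊆ S ∧ #S ≤ #A + κ}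

/-- `S ≺ T`, for two substructures of a common structure. -/
def StrongIn {M : Type u} [L.Structure M] (S T : L.Substructure M) : Prop :=
  S ≤ T ∧ K.Strong (S.comap T.subtype.toHom)

/-- `K`-embeddings: embeddings with strong image. -/
structure Emb (M N : Type u) [L.Structure M] [L.Structure N] where
  toEmbedding : M ↪[L] N
  strong_range : K.Strong toEmbedding.toHom.range

instance {M N : Type u} [L.Structure M] [L.Structure N] :
    CoeFun (K.Emb M N) (fun _ => M → N) := ⟨fun f => f.toEmbedding⟩

variable {K}

/-- Composition of `K`-embeddings. -/
def Emb.comp {M N P : Type u} [L.Structure M] [L.Structure N] [L.Structure P]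
    (g : K.Emb N P) (f : K.Emb M N) : K.Emb M P where
  toEmbedding := g.toEmbedding.comp f.toEmbedding
  strong_range := by
    have h := K.strong_trans g.strong_range
      (K.strong_equiv g.toEmbedding.equivRange f.strong_range)
    have e : (f.toEmbedding.toHom.range.map g.toEmbedding.equivRange.toHom).map
        g.toEmbedding.toHom.range.subtype.toHom
        = (g.toEmbedding.comp f.toEmbedding).toHom.range := by
      ext x
      simp only [FirstOrder.Language.Substructure.mem_map, FirstOrder.Language.Hom.mem_range]
      constructor
      · rintro ⟨_, ⟨_, ⟨m, rfl⟩, rfl⟩, rfl⟩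
        exact ⟨m, rfl⟩
      · rintro ⟨m, rfl⟩
        exact ⟨_, ⟨_, ⟨m, rfl⟩, rfl⟩, rfl⟩
    exact e ▸ h

/-- The inclusion of a strong substructure. -/
def Emb.incl {M : Type u} [L.Structure M] {S : L.Substructure M} (hS : K.Strong S) :
    K.Emb S M where
  toEmbedding := S.subtype
  strong_range := by
    have e : S.subtype.toHom.range = S := by
      ext x
      simp only [FirstOrder.Language.Hom.mem_range]
      constructor
      · rintro ⟨m, rfl⟩
        exact m.2
      · intro hx
        exact ⟨⟨x, hx⟩, rfl⟩
    exact e.symm ▸ hS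

/-- An isomorphism of models, as a `K`-embedding. -/
def Emb.ofEquiv {M N : Type u} [L.Structure M] [L.Structure N] (hN : K.Mem N) (e : M ≃[L] N) :
    K.Emb M N where
  toEmbedding := e.toEmbedding
  strong_range := by
    have h : e.toEmbedding.toHom.range = ⊤ := by
      ext x
      simp only [FirstOrder.Language.Hom.mem_range, FirstOrder.Language.Substructure.mem_top, iff_true]
      exact ⟨e.symm x, e.apply_symm_apply x⟩
    exact h.symm ▸ K.strong_top hN

variable (K)

/-- The amalgamation property. -/
def Amalgamation : Prop :=
  ∀ (M₀ M₁ M₂ : Type u) [L.Structure M₀] [L.Structure M₁] [L.Structure M₂]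
    (f₁ : K.Emb M₀ M₁) (f₂ : K.Emb M₀ M₂),
    ∃ (N : Type u) (_ : L.Structure N) (g₁ : K.Emb M₁ N) (g₂ : K.Emb M₂ N),
      ∀ x : M₀, g₁ (f₁ x) = g₂ (f₂ x)

/-- The joint embedding property. -/
def JointEmbedding : Prop :=
  ∀ (M₁ M₂ : Type u) [L.Structure M₁] [L.Structure M₂], K.Mem M₁ → K.Mem M₂ →
    ∃ (N : Type u) (_ : L.Structure N), Nonempty (K.Emb M₁ N) ∧ Nonempty (K.Emb M₂ N)

/-- There is no maximal model of cardinality `lam`: each has a proper strong extension. -/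
def NoMaximal (lam : Cardinal.{u}) : Prop :=
  ∀ (M : Type u) [L.Structure M], K.Mem M → #M = lam →
    ∃ (N : Type u) (_ : L.Structure N) (f : K.Emb M N), ¬ Function.Surjective f

/-- A representative of a Galois type over `M`: a strong extension of `M` and an element of it. -/
structure PreType (M : Type u) [L.Structure M] where
  ext : Type u
  [str : L.Structure ext]
  emb : K.Emb M ext
  elt : ext

attribute [instance] PreType.str

variable {K} in
/-- `p` and `q` are identified by amalgamating their extensions over `M`. -/
def PreType.Rel {M : Type u} [L.Structure M] (p q : K.PreType M) : Prop :=
  ∃ (N : Type u) (_ : L.Structure N) (g : K.Emb p.ext N) (h : K.Emb q.ext N),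
    (∀ x : M, g (p.emb x) = h (q.emb x)) ∧ g p.elt = h q.elt

/-- The set `ga-S(M)` of Galois types over `M`: representatives modulo the equivalence relation
generated by `PreType.Rel`. -/
def GaS (M : Type u) [L.Structure M] : Type (u + 1) :=
  Quot (PreType.Rel (K := K) (M := M))

variable {K}

/-- The Galois type `tp(a / M; N)`, where `f` embeds `M` in `N`. -/
def galoisType {M N : Type u} [L.Structure M] [L.Structure N] (f : K.Emb M N) (a : N) : K.GaS M :=
  Quot.mk _ ⟨N, f, a⟩

/-- The pull-back of a Galois type along a `K`-embedding. Along an inclusion it is the restriction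
of the type, along an isomorphism `e` it is the image of the type under `e⁻¹`. -/
def GaS.comap {M N : Type u} [L.Structure M] [L.Structure N] (f : K.Emb M N) :
    K.GaS N → K.GaS M :=
  Quot.map (fun p => ⟨p.ext, p.emb.comp f, p.elt⟩) (by
    rintro p q ⟨P, _, g, h, h1, h2⟩
    exact ⟨P, _, g, h, fun x => h1 (f x), h2⟩)

/-- The restriction `p ↾ S` to a strong substructure `S`. -/
def GaS.restrict {M : Type u} [L.Structure M] (p : K.GaS M) {S : L.Substructure M}
    (hS : K.Strong S) : K.GaS S :=
  p.comap (Emb.incl hS)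

/-- The image `h(p)` of a Galois type under an isomorphism of models. -/
def GaS.map {M N : Type u} [L.Structure M] [L.Structure N] (hM : K.Mem M) (h : M ≃[L] N)
    (p : K.GaS M) : K.GaS N :=
  p.comap (Emb.ofEquiv hM h.symm)

/-- The type `p` over `M` `μ`-splits over `N`: there are `N₁`, `N₂` of cardinality `μ` with
`N ≺ N₁ ≺ M`, `N ≺ N₂ ≺ M` and an isomorphism `h : N₁ ≅ N₂` over `N` with
`h(p ↾ N₁) ≠ p ↾ N₂`. -/
def GaS.Splits {M : Type u} [L.Structure M] (μ : Cardinal.{u}) (p : K.GaS M)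
    (N : L.Substructure M) : Prop :=
  ∃ (N₁ N₂ : L.Substructure M) (h₁ : K.Strong N₁) (h₂ : K.Strong N₂) (h : N₁ ≃[L] N₂),
    #N₁ = μ ∧ #N₂ = μ ∧ K.StrongIn N N₁ ∧ K.StrongIn N N₂ ∧
    (∀ x : N₁, (x : M) ∈ N → (h x : M) = x) ∧
    (p.restrict h₁).map (K.mem_of_strong h₁).1 h ≠ p.restrict h₂

variable (K)

/-- Galois stability in `μ`. -/
def Stable (μ : Cardinal.{u}) : Prop :=
  ∀ (M : Type u) [L.Structure M], K.Mem M → #M = μ → #(K.GaS M) ≤ Cardinal.lift.{u + 1} μ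

/-- `M` is universal over `S ≺ M`: every strong extension of `S` of the same cardinality as `S`
embeds in `M` over `S`. -/
def UniversalOver {M : Type u} [L.Structure M] (S : L.Substructure M) : Prop :=
  K.Strong S ∧ ∀ (N : Type u) [L.Structure N] (f : K.Emb S N), #N = #S →
    ∃ g : K.Emb N M, ∀ x : S, g (f x) = x

/-- `T` is universal over `S`, for two substructures `S ≤ T` of a common structure. -/
def UniversalIn {M : Type u} [L.Structure M] (S T : L.Substructure M) : Prop :=
  S ≤ T ∧ K.UniversalOver (S.comap T.subtype.toHom)

/-- `M` is a `(μ, θ)`-limit model: the union of an increasing continuous chain of length `θ` of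
models of cardinality `μ`, each successor member of which is universal over its predecessor. -/
def IsLimit (μ : Cardinal.{u}) (θ : Ordinal.{u}) (M : Type u) [L.Structure M] : Prop :=
  ∃ S : Ordinal.{u} → L.Substructure M,
    (∀ i < θ, #(S i) = μ) ∧
    (∀ i j, i ≤ j → j < θ → K.StrongIn (S i) (S j)) ∧
    (∀ i < θ, Order.IsSuccLimit i → ∀ x, x ∈ S i → ∃ j < i, x ∈ S j) ∧
    (∀ i, Order.succ i < θ → K.UniversalIn (S i) (S (Order.succ i))) ∧
    (∀ x : M, ∃ i < θ, x ∈ S i)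

/-- `M` is a limit model of cardinality `μ`: a `(μ, θ)`-limit model for a limit ordinal
`θ < μ⁺`. -/
def IsLimitModel (μ : Cardinal.{u}) (M : Type u) [L.Structure M] : Prop :=
  ∃ θ : Ordinal.{u}, Order.IsSuccLimit θ ∧ θ < (Order.succ μ).ord ∧ K.IsLimit μ θ M

/-- `μ`-superstability: stability in `μ`, and for every infinite `α`, every increasing sequence
`⟨M_i : i < α⟩` of limit models of cardinality `μ` with `M_{i+1}` universal over `M_i`, and every
Galois type `p` over the union, there is `i < α` such that `p` does not `μ`-split over `M_i`. -/
def Superstable (μ : Cardinal.{u}) : Prop :=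
  K.Stable μ ∧
  ∀ α : Ordinal.{u}, Ordinal.omega0 ≤ α →
    ∀ (M : Type u) [L.Structure M] (S : Ordinal.{u} → L.Substructure M),
      (∀ i < α, K.IsLimitModel μ (S i)) →
      (∀ i j, i ≤ j → j < α → K.StrongIn (S i) (S j)) →
      (∀ i, Order.succ i < α → K.UniversalIn (S i) (S (Order.succ i))) →
      (∀ x : M, ∃ i < α, x ∈ S i) →
      ∀ p : K.GaS M, ∃ i < α, ¬ p.Splits μ (S i)

/-- All limit models of cardinality `μ` are isomorphic. -/
def UniqueLimitModel (μ : Cardinal.{u}) : Prop :=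
  ∀ (M₁ M₂ : Type u) [L.Structure M₁] [L.Structure M₂],
    K.IsLimitModel μ M₁ → K.IsLimitModel μ M₂ → Nonempty (M₁ ≃[L] M₂)

/-- `M` is a `lam`-saturated model: it realizes every Galois type over every strong substructure of
cardinality less than `lam`. -/
def Saturated (lam : Cardinal.{u}) (M : Type u) [L.Structure M] : Prop :=
  K.Mem M ∧ ∀ (S : L.Substructure M) (hS : K.Strong S), #S < lam →
    ∀ p : K.GaS S, ∃ a : M, galoisType (Emb.incl hS) a = p

end AEC

/-! Let p be a type over a submodel S of the union with at most μ elements. If S lies in one M_i,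
saturation of M_i realizes p. Otherwise cof θ ≤ μ, and along a cofinal sequence t of length cof θ
one picks limit models N_i ≺ M_{t(i)} of size μ, with N_{i+1} universal over N_i, whose union C
contains S. Amalgamation extends p to C, and μ-superstability gives an i such that the extension
does not μ-split over N_i. It is then realized in M_{t(i+1)}, which contains N_{i+1} but in general
not C.

This last claim is `exists_realization_of_nonSplit`. Let B be universal over A, let p over C ⊇ B not
split over A, and suppose that a μ⁺-saturated M₀ ⊇ B has no realization of p. Models of size μ⁺
embed in M₀ over B (`Saturated.exists_emb_succ`), so the omission can be copied: every X ⊇ B of size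
μ⁺ has an extension of size μ⁺ containing a copy of C over B such that no element of X realizes p
over that copy. Iterating ω times, with universal extensions, inside a μ⁺⁺-saturated model yields a
limit model of length ω. By uniqueness it is isomorphic to the limit model of length μ⁺, hence
μ⁺-saturated. It therefore realizes the non-splitting extension of p ↾ B to a model D of size μ
containing all the copies. The realization appears at some finite stage n, and uniqueness of
non-splitting extensions (`NonSplit.unique`) makes it realize p over the n-th copy, a contradiction.

The supporting facts are classical: stability gives saturated extensions
(`exists_saturated_extension`), and saturated models are homogeneous and contain universal
extensions of their small submodels (`universalWithin_of_chain`). -/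

namespace AEC

open FirstOrder.Language

variable {L : FirstOrder.Language.{u, u}} {K : AEC L}

/-! ### Strong embeddings and coherence -/

section Embeddings

variable {M N P : Type u} [L.Structure M] [L.Structure N] [L.Structure P]

theorem Emb.ext {f g : K.Emb M N} (h : ∀ x, f x = g x) : f = g := by
  cases f; cases g
  congr 1
  exact FirstOrder.Language.Embedding.ext h

theorem Emb.injective (f : K.Emb M N) : Function.Injective f := f.toEmbedding.injective

/-- The image of a `K`-embedding. -/
def Emb.range (f : K.Emb M N) : L.Substructure N := f.toEmbedding.toHom.range

theorem Emb.mem_range {f : K.Emb M N} {y : N} : y ∈ f.range ↔ ∃ x, f x = y := Hom.mem_range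

theorem Emb.strong (f : K.Emb M N) : K.Strong f.range := f.strong_range

theorem Emb.mem_cod (f : K.Emb M N) : K.Mem N := (K.mem_of_strong f.strong_range).2

theorem Emb.mem_dom (f : K.Emb M N) : K.Mem M :=
  K.mem_equiv f.toEmbedding.equivRange.symm (K.mem_of_strong f.strong_range).1

@[simp] theorem Emb.comp_apply (g : K.Emb N P) (f : K.Emb M N) (x : M) :
    g.comp f x = g (f x) := rfl

@[simp] theorem Emb.incl_apply {S : L.Substructure M} (hS : K.Strong S) (x : S) :
    Emb.incl hS x = x := rfl

@[simp] theorem Emb.ofEquiv_apply (hN : K.Mem N) (e : M ≃[L] N) (x : M) :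
    Emb.ofEquiv hN e x = e x := rfl

/-- The identity as a `K`-embedding. -/
def Emb.refl (hM : K.Mem M) : K.Emb M M := Emb.ofEquiv hM (FirstOrder.Language.Equiv.refl L M)

@[simp] theorem Emb.refl_apply (hM : K.Mem M) (x : M) : Emb.refl hM x = x := rfl

theorem Emb.mk_card_range (f : K.Emb M N) : #f.range = #M :=
  (Cardinal.mk_congr f.toEmbedding.equivRange.toEquiv).symm

/-- Coherence for `K`-embeddings: a `K`-embedding into `P` whose image lies in the image of the
`K`-embedding `g` factors through `g`. -/
theorem Emb.lift (g : K.Emb N P) (h : K.Emb M P) (hr : ∀ x, ∃ y, g y = h x) :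
    ∃ f : K.Emb M N, ∀ x, g (f x) = h x := by
  choose F hF using hr
  let e : M ↪[L] N :=
    { toFun := F
      inj' := fun x y hxy => h.injective (by rw [← hF, ← hF, hxy])
      map_fun' := by
        intro n f x
        apply g.injective
        rw [hF]
        refine (h.toEmbedding.map_fun f x).trans ?_
        refine Eq.trans ?_ (g.toEmbedding.map_fun f (F ∘ x)).symm
        congr 1
        funext k
        exact (hF (x k)).symm
      map_rel' := by
        intro n r x
        refine Iff.trans ?_ (h.toEmbedding.map_rel r x)
        refine (g.toEmbedding.map_rel r (F ∘ x)).symm.trans ?_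
        have : (⇑g.toEmbedding ∘ F ∘ x) = ⇑h.toEmbedding ∘ x := by
          funext k
          exact hF (x k)
        rw [this] }
  refine ⟨⟨e, ?_⟩, hF⟩
  have hle : h.range ≤ g.range := by
    intro y hy
    obtain ⟨x, rfl⟩ := Emb.mem_range.1 hy
    exact Emb.mem_range.2 ⟨F x, hF x⟩
  -- Coherence inside P makes the image of h strong in the image of g; the inverse isomorphism
  -- carries this back to N.
  have h1 := K.strong_equiv g.toEmbedding.equivRange.symm
    (K.coherence hle h.strong g.strong)
  convert h1 using 1
  ext y
  simp only [Hom.mem_range, Substructure.mem_map, Substructure.mem_comap]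
  constructor
  · rintro ⟨x, rfl⟩
    refine ⟨g.toEmbedding.equivRange (F x), ?_, ?_⟩
    · exact Emb.mem_range.2 ⟨x, (hF x).symm⟩
    · exact g.toEmbedding.equivRange.symm_apply_apply (F x)
  · rintro ⟨z, hz, rfl⟩
    obtain ⟨x, hx⟩ := Emb.mem_range.1 hz
    refine ⟨x, g.injective ?_⟩
    refine (hF x).trans (hx.trans ?_)
    obtain ⟨w, rfl⟩ := g.toEmbedding.equivRange.surjective z
    change _ = g (g.toEmbedding.equivRange.symm (g.toEmbedding.equivRange w))
    rw [FirstOrder.Language.Equiv.symm_apply_apply]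
    rfl

theorem strong_of_strongIn {S T : L.Substructure M} (hT : K.Strong T) (h : K.StrongIn S T) :
    K.Strong S := by
  have h1 := K.strong_trans hT h.2
  convert h1 using 1
  ext y
  simp only [Substructure.mem_map, Substructure.mem_comap]
  constructor
  · intro hy
    exact ⟨⟨y, h.1 hy⟩, hy, rfl⟩
  · rintro ⟨z, hz, rfl⟩
    exact hz

theorem strongIn_of_le {S T : L.Substructure M} (hS : K.Strong S) (hT : K.Strong T) (h : S ≤ T) :
    K.StrongIn S T := ⟨h, K.coherence h hS hT⟩

/-- The inclusion of a strong substructure in another one. -/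
theorem exists_inclusion {S T : L.Substructure M} (hS : K.Strong S) (hT : K.Strong T)
    (h : S ≤ T) : ∃ f : K.Emb S T, ∀ x, (f x : M) = x :=
  Emb.lift (Emb.incl hT) (Emb.incl hS) fun x => ⟨⟨x, h x.2⟩, rfl⟩

/-- Inclusions between strong substructures as `K`-embeddings. -/
noncomputable def inclLE {S T : L.Substructure M} (hS : K.Strong S) (hT : K.Strong T)
    (h : S ≤ T) : K.Emb S T := (exists_inclusion hS hT h).choose

@[simp] theorem coe_inclLE {S T : L.Substructure M} (hS : K.Strong S) (hT : K.Strong T)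
    (h : S ≤ T) (x : S) : (inclLE hS hT h x : M) = x := (exists_inclusion hS hT h).choose_spec x

theorem Emb.exists_inv (f : K.Emb M N) (hf : Function.Surjective f) :
    ∃ g : K.Emb N M, (∀ x, g (f x) = x) ∧ ∀ y, f (g y) = y := by
  obtain ⟨g, hg⟩ := Emb.lift f (Emb.refl f.mem_cod) hf
  exact ⟨g, fun x => f.injective (hg (f x)), hg⟩

/-- The image of a strong substructure under a `K`-embedding is strong. -/
theorem Emb.strong_map (f : K.Emb M N) {S : L.Substructure M} (hS : K.Strong S) :
    K.Strong (S.map f.toEmbedding.toHom) := by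
  have h := (f.comp (Emb.incl hS)).strong
  convert h using 1
  ext y
  rw [Emb.mem_range, Substructure.mem_map]
  constructor
  · rintro ⟨x, hx, rfl⟩
    exact ⟨⟨x, hx⟩, rfl⟩
  · rintro ⟨x, rfl⟩
    exact ⟨x, x.2, rfl⟩

/-- The preimage of a strong substructure contained in the image is strong. -/
theorem Emb.strong_comap (f : K.Emb M N) {T : L.Substructure N} (hT : K.Strong T)
    (h : ∀ y ∈ T, ∃ x, f x = y) : K.Strong (T.comap f.toEmbedding.toHom) := by
  obtain ⟨g, hg⟩ := Emb.lift f (Emb.incl hT) (fun y => h y y.2)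
  convert g.strong using 1
  ext x
  rw [Emb.mem_range, Substructure.mem_comap]
  constructor
  · intro hx
    exact ⟨⟨f x, hx⟩, f.injective (hg _)⟩
  · rintro ⟨y, rfl⟩
    have := hg y
    change f (g y) ∈ T
    rw [this]
    exact y.2

end Embeddings

/-! ### Downward Löwenheim–Skolem with prescribed cardinality -/

section LowenheimSkolem

theorem LS_spec (K : AEC L) : ℵ₀ ≤ K.LS ∧ L.card ≤ K.LS ∧
    ∀ (M : Type u) [L.Structure M], K.Mem M → ∀ A : Set M,
      ∃ S : L.Substructure M, K.Strong S ∧ A ⊆ S ∧ #S ≤ #A + K.LS :=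
  csInf_mem (s := {κ | ℵ₀ ≤ κ ∧ L.card ≤ κ ∧
    ∀ (M : Type u) [L.Structure M], K.Mem M → ∀ A : Set M,
      ∃ S : L.Substructure M, K.Strong S ∧ A ⊆ S ∧ #S ≤ #A + κ}) K.exists_LS

variable {M : Type u} [L.Structure M] {lam : Cardinal.{u}}

theorem aleph0_le_of_LS_le (h : K.LS ≤ lam) : ℵ₀ ≤ lam := (LS_spec K).1.trans h

theorem exists_strong_le (h : K.LS ≤ lam) (hM : K.Mem M) (A : Set M) (hA : #A ≤ lam) :
    ∃ S : L.Substructure M, K.Strong S ∧ A ⊆ S ∧ #S ≤ lam := by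
  obtain ⟨S, h1, h2, h3⟩ := (LS_spec K).2.2 M hM A
  exact ⟨S, h1, h2, h3.trans (Cardinal.add_le_of_le (aleph0_le_of_LS_le h) hA h)⟩

theorem exists_strong_eq (h : K.LS ≤ lam) (hM : K.Mem M) (hc : lam ≤ #M) (A : Set M)
    (hA : #A ≤ lam) : ∃ S : L.Substructure M, K.Strong S ∧ A ⊆ S ∧ #S = lam := by
  obtain ⟨B, hB⟩ := Cardinal.le_mk_iff_exists_set.1 hc
  obtain ⟨S, h1, h2, h3⟩ := exists_strong_le h hM (A ∪ B)
    ((Cardinal.mk_union_le _ _).trans (Cardinal.add_le_of_le (aleph0_le_of_LS_le h) hA hB.le))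
  refine ⟨S, h1, Set.subset_union_left.trans h2, le_antisymm h3 ?_⟩
  rw [← hB]
  exact Cardinal.mk_le_mk_of_subset (Set.subset_union_right.trans h2)

end LowenheimSkolem

/-! ### Galois types under amalgamation -/

section Types

variable {M N P : Type u} [L.Structure M] [L.Structure N] [L.Structure P]

/-- Only transitivity needs amalgamation: the two witnesses are amalgamated over the extension that
carries the middle type. -/
theorem PreType.Rel.equivalence (hAP : K.Amalgamation) :
    Equivalence (PreType.Rel (K := K) (M := M)) where
  refl p := ⟨p.ext, _, Emb.refl p.emb.mem_cod, Emb.refl p.emb.mem_cod, fun _ => rfl, rfl⟩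
  symm := by
    rintro p q ⟨X, _, g, h, h1, h2⟩
    exact ⟨X, _, h, g, fun x => (h1 x).symm, h2.symm⟩
  trans := by
    rintro p q r ⟨X, _, g, h, h1, h2⟩ ⟨Y, _, g', h', h1', h2'⟩
    obtain ⟨Z, _, k, l, hkl⟩ := hAP q.ext X Y h g'
    refine ⟨Z, _, k.comp g, l.comp h', fun x => ?_, ?_⟩
    · simp only [Emb.comp_apply, h1, hkl, h1']
    · simp only [Emb.comp_apply, h2, hkl, h2']

theorem galoisType_eq_iff (hAP : K.Amalgamation) {f : K.Emb M N} {a : N} {g : K.Emb M P} {b : P} :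
    galoisType f a = galoisType g b ↔ ∃ (Z : Type u) (_ : L.Structure Z) (k : K.Emb N Z)
      (l : K.Emb P Z), (∀ x : M, k (f x) = l (g x)) ∧ k a = l b := by
  constructor
  · intro h
    exact (Equivalence.eqvGen_iff (PreType.Rel.equivalence hAP)).1 (Quot.eqvGen_exact h)
  · rintro ⟨Z, _, k, l, h1, h2⟩
    exact Quot.sound ⟨Z, _, k, l, h1, h2⟩

@[simp] theorem comap_galoisType (f : K.Emb M N) (g : K.Emb N P) (a : P) :
    (galoisType g a).comap f = galoisType (g.comp f) a := rfl

theorem GaS.exists_rep (p : K.GaS M) : ∃ (N : Type u) (_ : L.Structure N) (f : K.Emb M N) (a : N),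
    galoisType f a = p := by
  obtain ⟨q, rfl⟩ := Quot.exists_rep p
  exact ⟨q.ext, _, q.emb, q.elt, rfl⟩

theorem GaS.comap_comap (f : K.Emb M N) (g : K.Emb N P) (p : K.GaS P) :
    (p.comap g).comap f = p.comap (g.comp f) := by
  obtain ⟨N, _, h, a, rfl⟩ := p.exists_rep
  rfl

theorem GaS.comap_refl (hM : K.Mem M) (p : K.GaS M) : p.comap (Emb.refl hM) = p := by
  obtain ⟨N, _, h, a, rfl⟩ := p.exists_rep
  rfl

/-- Enlarging the ambient model does not change a type: the identity of P and g identify the two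
representatives. -/
theorem galoisType_comp (g : K.Emb N P) (f : K.Emb M N) (a : N) :
    galoisType (g.comp f) (g a) = galoisType f a :=
  Quot.sound ⟨P, _, Emb.refl g.mem_cod, g, fun _ => rfl, rfl⟩

/-- A type is carried along any `K`-embedding of its domain. -/
theorem GaS.exists_extension (hAP : K.Amalgamation) (f : K.Emb M N) (p : K.GaS M) :
    ∃ q : K.GaS N, q.comap f = p := by
  obtain ⟨P, _, g, a, rfl⟩ := p.exists_rep
  obtain ⟨Z, _, k, l, h⟩ := hAP M N P f g
  refine ⟨galoisType k (l a), ?_⟩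
  have : k.comp f = l.comp g := Emb.ext h
  rw [comap_galoisType, this, galoisType_comp]

theorem GaS.exists_small_rep {lam : Cardinal.{u}} (hLS : K.LS ≤ lam) (hM : #M ≤ lam)
    (p : K.GaS M) : ∃ (N : Type u) (_ : L.Structure N) (f : K.Emb M N) (a : N),
      #N ≤ lam ∧ galoisType f a = p := by
  obtain ⟨P, _, g, a, rfl⟩ := p.exists_rep
  obtain ⟨S, hS, hA, hc⟩ := exists_strong_le hLS g.mem_cod ((g.range : Set P) ∪ {a}) (by
    refine (Cardinal.mk_union_le _ _).trans (Cardinal.add_le_of_le (aleph0_le_of_LS_le hLS) ?_ ?_)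
    · exact g.mk_card_range.le.trans hM
    · rw [Cardinal.mk_singleton]
      exact Cardinal.one_lt_aleph0.le.trans (aleph0_le_of_LS_le hLS))
  obtain ⟨f, hf⟩ := Emb.lift (Emb.incl hS) g
    (fun x => ⟨⟨g x, hA (Or.inl (Emb.mem_range.2 ⟨x, rfl⟩))⟩, rfl⟩)
  refine ⟨S, _, f, ⟨a, hA (Or.inr rfl)⟩, hc, ?_⟩
  rw [← galoisType_comp (Emb.incl hS) f]
  congr 1
  exact Emb.ext hf

end Types

/-! ### Transfinite recursion and increasing chains -/

section Chains

universe v w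

open Order

/-- Transfinite recursion with a choice at every stage. -/
theorem exists_ordinal_seq {P : Type v} [Nonempty P]
    (R : ∀ i : Ordinal.{u}, (∀ j, j < i → P) → P → Prop)
    (h : ∀ i, ∀ g : Ordinal.{u} → P, (∀ j < i, R j (fun k _ => g k) (g j)) →
      ∃ x, R i (fun k _ => g k) x) :
    ∃ g : Ordinal.{u} → P, ∀ i, R i (fun k _ => g k) (g i) := by
  classical
  let F : ∀ i : Ordinal.{u}, (∀ j, j < i → P) → P := fun i ih =>
    if hx : ∃ x, R i ih x then hx.choose else Classical.arbitrary P
  let g : Ordinal.{u} → P := Ordinal.lt_wf.fix F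
  have hg : ∀ i, g i = F i (fun k _ => g k) := fun i => Ordinal.lt_wf.fix_eq F i
  refine ⟨g, fun i => ?_⟩
  induction i using WellFoundedLT.induction with
  | ind i ih =>
    have hx := h i g ih
    rw [hg i]
    simp only [F]
    rw [dif_pos hx]
    exact hx.choose_spec

/-- Increasing continuous chains of length `δ` in a preorder, from a successor step and unions. -/
theorem exists_chain {P : Type v} [Preorder P] {W : Type w} (c : P → Set W) (δ : Ordinal.{u})
    (Good : Ordinal.{u} → P → Prop) (Q : Ordinal.{u} → P → P → Prop) (p₀ : P) (h₀ : Good 0 p₀)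
    (hsucc : ∀ i < δ, ∀ p, p₀ ≤ p → Good i p → ∃ q, p ≤ q ∧ Good (succ i) q ∧ Q i p q)
    (hlim : ∀ i ≤ δ, IsSuccLimit i → ∀ f : Ordinal.{u} → P, f 0 = p₀ →
      (∀ j k, j ≤ k → k < i → f j ≤ f k) → (∀ j < i, Good j (f j)) →
      ∃ q, Good i q ∧ (∀ j < i, f j ≤ q) ∧ ∀ x ∈ c q, ∃ j < i, x ∈ c (f j)) :
    ∃ S : Ordinal.{u} → P, S 0 = p₀ ∧ (∀ i ≤ δ, Good i (S i)) ∧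
      (∀ i j, i ≤ j → j ≤ δ → S i ≤ S j) ∧ (∀ i < δ, Q i (S i) (S (succ i))) ∧
      ∀ i ≤ δ, IsSuccLimit i → ∀ x ∈ c (S i), ∃ j < i, x ∈ c (S j) := by
  have : Nonempty P := ⟨p₀⟩
  -- The recursion runs over all ordinals, so every requirement is guarded by `i ≤ δ`; beyond δ the
  -- value is the dummy `p₀`.
  obtain ⟨S, hS⟩ := exists_ordinal_seq (P := P)
    (fun i g q => i ≤ δ → ((i = 0 → q = p₀) ∧ Good i q ∧ (∀ j (hj : j < i), g j hj ≤ q) ∧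
      (∀ j (hj : j < i), succ j = i → Q j (g j hj) q) ∧
      (IsSuccLimit i → ∀ x ∈ c q, ∃ j, ∃ hj : j < i, x ∈ c (g j hj)))) (by
    intro i g hg
    by_cases hi : i ≤ δ
    swap
    · exact ⟨p₀, fun h => absurd h hi⟩
    have hmono : ∀ j k, j ≤ k → k < i → g j ≤ g k := by
      intro j k hjk hk
      rcases hjk.eq_or_lt with rfl | hlt
      · exact le_rfl
      · exact (hg k hk (hk.le.trans hi)).2.2.1 j hlt
    rcases Ordinal.zero_or_succ_or_isSuccLimit i with rfl | ⟨j, rfl⟩ | hlimi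
    · refine ⟨p₀, fun _ => ⟨fun _ => rfl, h₀, fun j hj => absurd hj (not_lt_bot),
        fun j hj => absurd hj (not_lt_bot), fun h => absurd h.1 (by simp)⟩⟩
    · have hj : j < succ j := lt_succ j
      have hjδ : j < δ := lt_of_lt_of_le hj hi
      have h0 : g 0 = p₀ := (hg 0 (lt_of_le_of_lt (zero_le) hj) (zero_le)).1 rfl
      obtain ⟨q, hq1, hq2, hq3⟩ := hsucc j hjδ (g j)
        (by rw [← h0]; exact hmono 0 j (zero_le) hj) (hg j hj hjδ.le).2.1
      refine ⟨q, fun _ => ⟨fun h => absurd h (by simp), hq2,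
        fun k hk => (hmono k j (lt_succ_iff.1 hk) hj).trans hq1, ?_, ?_⟩⟩
      · intro k hk hkj
        obtain rfl := succ_injective hkj
        exact hq3
      · intro h
        exact absurd h.isSuccPrelimit (not_isSuccPrelimit_succ j)
    · have h0 : (0 : Ordinal) < i := by
        rcases eq_or_ne i 0 with rfl | h
        · exact absurd hlimi.1 (by simp)
        · exact pos_iff_ne_zero.2 h
      obtain ⟨q, hq1, hq2, hq3⟩ := hlim i hi hlimi g ((hg 0 h0 (zero_le)).1 rfl) hmono
        (fun j hj => (hg j hj (hj.le.trans hi)).2.1)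
      refine ⟨q, fun _ => ⟨fun h => absurd h h0.ne', hq1, fun j hj => hq2 j hj, ?_, ?_⟩⟩
      · rintro j hj rfl
        exact absurd hlimi.isSuccPrelimit (not_isSuccPrelimit_succ j)
      · intro _ x hx
        obtain ⟨j, hj, hxj⟩ := hq3 x hx
        exact ⟨j, hj, hxj⟩)
  refine ⟨S, (hS 0 (zero_le)).1 rfl, fun i hi => (hS i hi).2.1, ?_, ?_, ?_⟩
  · intro i j hij hj
    rcases hij.eq_or_lt with rfl | hlt
    · exact le_rfl
    · exact (hS j hj).2.2.1 i hlt
  · intro i hi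
    exact (hS (succ i) (succ_le_of_lt hi)).2.2.2.1 i (lt_succ i) rfl
  · intro i hi hl x hx
    obtain ⟨j, hj, h⟩ := (hS i hi).2.2.2.2 hl x hx
    exact ⟨j, hj, h⟩

/-- Finitely many elements of an increasing union lie in a common member. -/
theorem exists_common_index {W : Type w} {δ : Ordinal.{u}} (hδ : 0 < δ) (A : Ordinal.{u} → Set W)
    (hA : ∀ i j, i ≤ j → j < δ → A i ⊆ A j) {n : ℕ} (x : Fin n → W)
    (hx : ∀ k, ∃ i < δ, x k ∈ A i) : ∃ i < δ, ∀ k, x k ∈ A i := by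
  choose f hf using hx
  -- Inserting 0 keeps the finite set nonempty for the empty tuple, which arises from constant
  -- symbols.
  let s : Finset Ordinal := insert 0 (Finset.univ.image f)
  have hs : s.Nonempty := ⟨0, Finset.mem_insert_self _ _⟩
  have hm : s.max' hs < δ := by
    rw [Finset.max'_lt_iff]
    intro y hy
    rcases Finset.mem_insert.1 hy with rfl | hy
    · exact hδ
    · obtain ⟨k, _, rfl⟩ := Finset.mem_image.1 hy
      exact (hf k).1
  refine ⟨s.max' hs, hm, fun k => hA (f k) _ (Finset.le_max' _ _ ?_) hm (hf k).2⟩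
  exact Finset.mem_insert_of_mem (Finset.mem_image_of_mem _ (Finset.mem_univ k))

/-- A coherent family of functions on an increasing chain of sets has a common extension. -/
theorem exists_glued_function {X : Type v} {Y : Type w} [Nonempty Y] {δ : Ordinal.{u}}
    (A : Ordinal.{u} → Set X) (F : Ordinal.{u} → X → Y)
    (h : ∀ i j, i ≤ j → j < δ → ∀ x ∈ A i, F i x = F j x) :
    ∃ G : X → Y, ∀ i < δ, ∀ x ∈ A i, G x = F i x := by
  classical
  refine ⟨fun x => if hx : ∃ i < δ, x ∈ A i then F hx.choose x else Classical.arbitrary Y, ?_⟩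
  intro i hi x hx
  have hx' : ∃ i < δ, x ∈ A i := ⟨i, hi, hx⟩
  simp only [dif_pos hx']
  have hc := hx'.choose_spec
  rcases le_total i hx'.choose with hle | hle
  · exact (h _ _ hle hc.1 x hx).symm
  · exact h _ _ hle hi x hc.2

theorem mk_biUnion_ordinal_le {W : Type u} {lam : Cardinal.{u}} (hlam : ℵ₀ ≤ lam)
    {δ : Ordinal.{u}} (hδ : δ.card ≤ lam) (A : Ordinal.{u} → Set W) (hA : ∀ i < δ, #(A i) ≤ lam)
    (B : Set W) (hB : ∀ x ∈ B, ∃ i < δ, x ∈ A i) : #B ≤ lam := by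
  have h1 : B ⊆ ⋃ i : δ.ToType, A (Ordinal.ToType.mk.symm i : Set.Iio δ).1 := by
    intro x hx
    obtain ⟨i, hi, hxi⟩ := hB x hx
    refine Set.mem_iUnion.2 ⟨Ordinal.ToType.mk ⟨i, hi⟩, ?_⟩
    simpa using hxi
  refine (Cardinal.mk_le_mk_of_subset h1).trans ((Cardinal.mk_iUnion_le _).trans ?_)
  refine (mul_le_mul' (b := lam) (d := lam) (by simpa using hδ)
    (ciSup_le' fun i => hA _ ?_)).trans (Cardinal.mul_eq_self hlam).le
  exact (Ordinal.ToType.mk.symm i).2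

end Chains

/-! ### Unions of chains of substructures and of embeddings -/

theorem isSuccLimit_pos {δ : Ordinal.{u}} (hδ : Order.IsSuccLimit δ) : 0 < δ := by
  rcases eq_or_ne δ 0 with rfl | h
  · exact absurd hδ.1 (by simp)
  · exact pos_iff_ne_zero.2 h

/-- A function on the union of an increasing chain of substructures which restricts to a
`K`-embedding on every member of the chain is a `K`-embedding. -/
theorem exists_emb_union {M N : Type u} [L.Structure M] [L.Structure N] {δ : Ordinal.{u}}
    (hδ : Order.IsSuccLimit δ) (S : Ordinal.{u} → L.Substructure M) (U : L.Substructure M)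
    (hS : ∀ i j, i ≤ j → j < δ → S i ≤ S j) (hU : ∀ x, x ∈ U ↔ ∃ i < δ, x ∈ S i) (F : U → N)
    (hF : ∀ i < δ, ∃ f : K.Emb (S i) N, ∀ x (h : x ∈ S i) (hU : x ∈ U), f ⟨x, h⟩ = F ⟨x, hU⟩) :
    ∃ f : K.Emb U N, ∀ x, f x = F x := by
  classical
  choose f hf using hF
  -- Symbols are finitary, so each instance of injectivity or of preservation of a symbol takes
  -- place in a single member of the chain.
  have hfin : ∀ {n : ℕ} (x : Fin n → U), ∃ i, ∃ hi : i < δ, ∃ y : Fin n → S i,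
      (∀ k, (y k : M) = x k) ∧ ∀ k, f i hi (y k) = F (x k) := by
    intro n x
    obtain ⟨i, hi, h⟩ := exists_common_index (isSuccLimit_pos hδ) (fun i => (S i : Set M)) hS
      (fun k => (x k : M)) (fun k => (hU _).1 (x k).2)
    exact ⟨i, hi, fun k => ⟨x k, h k⟩, fun _ => rfl, fun k => hf i hi _ (h k) (x k).2⟩
  let e : U ↪[L] N :=
    { toFun := F
      inj' := by
        intro a b hab
        obtain ⟨i, hi, y, hy, hy'⟩ := hfin ![a, b]
        have h0 := hy' 0
        have h1 := hy' 1
        simp only [Matrix.cons_val_zero, Matrix.cons_val_one] at h0 h1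
        have : y 0 = y 1 := (f i hi).injective (by rw [h0, h1, hab])
        have h2 := hy 0
        rw [this, hy 1] at h2
        exact Subtype.ext h2.symm
      map_fun' := by
        intro n g x
        obtain ⟨i, hi, y, hy, hy'⟩ := hfin x
        have h1 : ((Structure.funMap g y : S i) : M) = (Structure.funMap g x : U) := by
          change Structure.funMap g (fun k => (y k : M)) = Structure.funMap g (fun k => (x k : M))
          simp only [hy]
        have h2 := hf i hi _ (Structure.funMap g y).2 (h1 ▸ (Structure.funMap g x).2)
        have h3 : (⟨(Structure.funMap g y : S i), h1 ▸ (Structure.funMap g x).2⟩ : U)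
          = Structure.funMap g x := Subtype.ext h1
        rw [h3] at h2
        rw [← h2]
        refine ((f i hi).toEmbedding.map_fun g y).trans ?_
        congr 1
        funext k
        exact hy' k
      map_rel' := by
        intro n r x
        obtain ⟨i, hi, y, hy, hy'⟩ := hfin x
        have h1 : F ∘ x = (f i hi).toEmbedding ∘ y := funext fun k => (hy' k).symm
        have h2 : Structure.RelMap r x ↔ Structure.RelMap r y := by
          change Structure.RelMap r (fun k => (x k : M)) ↔ Structure.RelMap r (fun k => (y k : M))
          simp only [hy]
        rw [h1, h2]
        exact (f i hi).toEmbedding.map_rel r y }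
  refine ⟨⟨e, ?_⟩, fun _ => rfl⟩
  let T : Ordinal.{u} → L.Substructure N := fun i => if h : i < δ then (f i h).range else ⊥
  have hT : ∀ i (h : i < δ), T i = (f i h).range := fun i h => dif_pos h
  have hFe : ∀ i (hi : i < δ) (x : S i) (hx : (x : M) ∈ U), f i hi x = F ⟨x, hx⟩ :=
    fun i hi x hx => hf i hi x x.2 hx
  have hSU : ∀ i < δ, ∀ x ∈ S i, x ∈ U := fun i hi x hx => (hU x).2 ⟨i, hi, hx⟩
  refine K.union_strong δ hδ T _ ?_ ?_ ?_
  · intro i j hij hj y hy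
    rw [hT i (hij.trans_lt hj), Emb.mem_range] at hy
    rw [hT j hj, Emb.mem_range]
    obtain ⟨x, rfl⟩ := hy
    refine ⟨⟨x, hS i j hij hj x.2⟩, ?_⟩
    rw [hFe i _ x (hSU i (hij.trans_lt hj) x x.2), hFe j hj _ (hSU i (hij.trans_lt hj) x x.2)]
  · intro i hi
    rw [hT i hi]
    exact (f i hi).strong
  · intro y
    rw [Hom.mem_range]
    constructor
    · rintro ⟨x, rfl⟩
      obtain ⟨i, hi, hx⟩ := (hU _).1 x.2
      refine ⟨i, hi, ?_⟩
      rw [hT i hi, Emb.mem_range]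
      exact ⟨⟨x, hx⟩, hFe i hi _ x.2⟩
    · rintro ⟨i, hi, hy⟩
      rw [hT i hi, Emb.mem_range] at hy
      obtain ⟨x, rfl⟩ := hy
      exact ⟨⟨x, hSU i hi x x.2⟩, (hFe i hi x (hSU i hi x x.2)).symm⟩

/-- The union of an increasing chain of substructures. -/
theorem exists_substructure_union {M : Type u} [L.Structure M] {δ : Ordinal.{u}} (hδ : 0 < δ)
    (S : Ordinal.{u} → L.Substructure M) (hS : ∀ i j, i ≤ j → j < δ → S i ≤ S j) :
    ∃ U : L.Substructure M, ∀ x, x ∈ U ↔ ∃ i < δ, x ∈ S i := by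
  refine ⟨⟨{x | ∃ i < δ, x ∈ S i}, ?_⟩, fun x => Iff.rfl⟩
  intro n f x hx
  obtain ⟨i, hi, h⟩ := exists_common_index hδ (fun i => (S i : Set M)) hS x hx
  exact ⟨i, hi, (S i).fun_mem f x h⟩

/-! ### Models on subsets of a fixed set, where chains of extensions have literal unions -/

variable (K) in
/-- Models of `K` whose universe is a subset of `W`. -/
structure ModelOn (W : Type u) where
  carrier : Set W
  [str : L.Structure carrier]
  mem : K.Mem carrier

attribute [instance] ModelOn.str

namespace ModelOn

variable {W : Type u}

/-- `m ≤ m'` if `m'` is a strong extension of `m`. -/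
instance : Preorder (K.ModelOn W) where
  le m m' := ∃ e : K.Emb m.carrier m'.carrier, ∀ x, (e x : W) = x
  le_refl m := ⟨Emb.refl m.mem, fun _ => rfl⟩
  le_trans := by
    rintro m₁ m₂ m₃ ⟨e, he⟩ ⟨f, hf⟩
    exact ⟨f.comp e, fun x => by rw [Emb.comp_apply, hf, he]⟩

/-- The inclusion of a model in a strong extension. -/
noncomputable def incl {m m' : K.ModelOn W} (h : m ≤ m') : K.Emb m.carrier m'.carrier := h.choose

@[simp] theorem coe_incl {m m' : K.ModelOn W} (h : m ≤ m') (x : m.carrier) :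
    (incl h x : W) = x := h.choose_spec x

theorem le_subset {m m' : K.ModelOn W} (h : m ≤ m') : m.carrier ⊆ m'.carrier := by
  intro x hx
  have := (incl h ⟨x, hx⟩).2
  rwa [coe_incl] at this

theorem exists_of_injective {N : Type u} [L.Structure N] (hN : K.Mem N) (φ : N → W)
    (hφ : Function.Injective φ) : ∃ (m : K.ModelOn W) (e : K.Emb N m.carrier),
      Function.Surjective e ∧ ∀ x, (e x : W) = φ x := by
  let e := Equiv.ofInjective φ hφ
  let : L.Structure (Set.range φ) := e.inducedStructure
  have hm : K.Mem (Set.range φ) := K.mem_equiv e.inducedStructureEquiv hN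
  exact ⟨⟨Set.range φ, hm⟩, Emb.ofEquiv hm e.inducedStructureEquiv, e.surjective, fun _ => rfl⟩

theorem exists_equiv {N : Type u} [L.Structure N] (hN : K.Mem N) (hc : #N ≤ #W) :
    ∃ (m : K.ModelOn W) (e : K.Emb N m.carrier), Function.Surjective e := by
  obtain ⟨φ⟩ := hc
  obtain ⟨m, e, he, -⟩ := exists_of_injective hN φ φ.injective
  exact ⟨m, e, he⟩

/-- Every strong extension of `m` is isomorphic over `m` to one with universe contained in `W`. -/
theorem exists_extension {lam : Cardinal.{u}} (hlam : ℵ₀ ≤ lam) (hW : #W = Order.succ lam)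
    (m : K.ModelOn W) (hm : #m.carrier ≤ lam) {N : Type u} [L.Structure N] (f : K.Emb m.carrier N)
    (hN : #N ≤ lam) : ∃ (m' : K.ModelOn W) (e : K.Emb N m'.carrier), Function.Surjective e ∧
      m ≤ m' ∧ ∀ x, (e (f x) : W) = x := by
  classical
  have hinf : Infinite W := by
    rw [Cardinal.infinite_iff, hW]
    exact hlam.trans (Order.le_succ _)
  -- Since W has size `lam⁺` and m at most `lam`, there is always room outside m for the new points
  -- of N.
  have hcompl : #(m.carrierᶜ : Set W) = #W := Cardinal.mk_compl_of_infinite _ (by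
    rw [hW, Order.lt_succ_iff]
    exact hm)
  have hle : #((Set.range f)ᶜ : Set N) ≤ #(m.carrierᶜ : Set W) := by
    rw [hcompl, hW]
    exact (Cardinal.mk_set_le _).trans (hN.trans (Order.le_succ _))
  obtain ⟨ι⟩ := hle
  let φ : N → W := fun y => if h : y ∈ Set.range f then h.choose else ι ⟨y, h⟩
  have h1 : ∀ x, φ (f x) = x := by
    intro x
    have h : f x ∈ Set.range f := ⟨x, rfl⟩
    simp only [φ, dif_pos h]
    rw [f.injective h.choose_spec]
  have h2 : ∀ y (h : y ∉ Set.range f), φ y = ι ⟨y, h⟩ := fun y h => dif_neg h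
  have hφ : Function.Injective φ := by
    intro y z hyz
    by_cases hy : y ∈ Set.range f <;> by_cases hz : z ∈ Set.range f
    · obtain ⟨x, rfl⟩ := hy
      obtain ⟨x', rfl⟩ := hz
      rw [h1, h1] at hyz
      rw [Subtype.ext hyz]
    · obtain ⟨x, rfl⟩ := hy
      rw [h1, h2 z hz] at hyz
      exact absurd x.2 (hyz ▸ (ι ⟨z, hz⟩).2)
    · obtain ⟨x, rfl⟩ := hz
      rw [h1, h2 y hy] at hyz
      exact absurd x.2 (hyz ▸ (ι ⟨y, hy⟩).2)
    · rw [h2 y hy, h2 z hz] at hyz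
      exact congrArg Subtype.val (ι.injective (Subtype.ext hyz))
  obtain ⟨m', e, he, he'⟩ := exists_of_injective f.mem_cod φ hφ
  refine ⟨m', e, he, ⟨e.comp f, ?_⟩, ?_⟩
  · intro x
    rw [Emb.comp_apply, he', h1]
  · intro x
    rw [he', h1]

/-- The union of an increasing chain of models. -/
theorem exists_union {δ : Ordinal.{u}} (hδ : Order.IsSuccLimit δ) (f : Ordinal.{u} → K.ModelOn W)
    (hf : ∀ i j, i ≤ j → j < δ → f i ≤ f j) : ∃ m : K.ModelOn W, (∀ i < δ, f i ≤ m) ∧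
      ∀ x, x ∈ m.carrier ↔ ∃ i < δ, x ∈ (f i).carrier := by
  classical
  let U : Set W := {x | ∃ i < δ, x ∈ (f i).carrier}
  have hfin : ∀ {n : ℕ} (x : Fin n → U), ∃ i < δ, ∀ k, (x k : W) ∈ (f i).carrier := fun x =>
    exists_common_index (isSuccLimit_pos hδ) (fun i => (f i).carrier)
      (fun i j hij hj => le_subset (hf i j hij hj)) _ (fun k => (x k).2)
  -- Symbols are interpreted on a tuple in some chosen member containing it; `hfun` and `hrel` show
  -- that the choice is immaterial.
  choose ind hind1 hind2 using @hfin
  let str : L.Structure U :=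
    { funMap := fun {n} g x => ⟨(Structure.funMap g
        (fun k => (⟨x k, hind2 x k⟩ : (f (ind x)).carrier)) : (f (ind x)).carrier),
        ⟨ind x, hind1 x, Subtype.prop _⟩⟩
      RelMap := fun {n} r x => Structure.RelMap r
        (fun k => (⟨x k, hind2 x k⟩ : (f (ind x)).carrier)) }
  have hfun : ∀ i < δ, ∀ j < δ, ∀ {n : ℕ} (g : L.Functions n) (y : Fin n → (f i).carrier)
      (z : Fin n → (f j).carrier), (∀ k, (y k : W) = z k) →
      ((Structure.funMap g y : (f i).carrier) : W) = (Structure.funMap g z : (f j).carrier) := by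
    have key : ∀ i j, i ≤ j → j < δ → ∀ {n : ℕ} (g : L.Functions n) (y : Fin n → (f i).carrier)
        (z : Fin n → (f j).carrier), (∀ k, (y k : W) = z k) →
        ((Structure.funMap g y : (f i).carrier) : W)
          = (Structure.funMap g z : (f j).carrier) := by
      intro i j hij hj n g y z hyz
      have h := (incl (hf i j hij hj)).toEmbedding.map_fun g y
      have h' : ((incl (hf i j hij hj)).toEmbedding ∘ y) = z :=
        funext fun k => Subtype.ext ((coe_incl _ _).trans (hyz k))
      rw [h'] at h
      rw [← h]
      exact (coe_incl (hf i j hij hj) _).symm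
    intro i hi j hj n g y z hyz
    rcases le_total i j with h | h
    · exact key i j h hj g y z hyz
    · exact (key j i h hi g z y (fun k => (hyz k).symm)).symm
  have hrel : ∀ i < δ, ∀ j < δ, ∀ {n : ℕ} (r : L.Relations n) (y : Fin n → (f i).carrier)
      (z : Fin n → (f j).carrier), (∀ k, (y k : W) = z k) →
      (Structure.RelMap r y ↔ Structure.RelMap r z) := by
    have key : ∀ i j, i ≤ j → j < δ → ∀ {n : ℕ} (r : L.Relations n) (y : Fin n → (f i).carrier)
        (z : Fin n → (f j).carrier), (∀ k, (y k : W) = z k) →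
        (Structure.RelMap r y ↔ Structure.RelMap r z) := by
      intro i j hij hj n r y z hyz
      have h := (incl (hf i j hij hj)).toEmbedding.map_rel r y
      have h' : ((incl (hf i j hij hj)).toEmbedding ∘ y) = z :=
        funext fun k => Subtype.ext ((coe_incl _ _).trans (hyz k))
      rw [h'] at h
      exact h.symm
    intro i hi j hj n r y z hyz
    rcases le_total i j with h | h
    · exact key i j h hj r y z hyz
    · exact (key j i h hi r z y (fun k => (hyz k).symm)).symm
  let emb : ∀ i, i < δ → ((f i).carrier ↪[L] U) := fun i hi =>
    { toFun := fun x => ⟨x, i, hi, x.2⟩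
      inj' := fun x y h => Subtype.ext (congrArg (fun t : U => (t : W)) h)
      map_fun' := fun {n} g x => Subtype.ext (hfun i hi _ (hind1 _) g _ _ (fun _ => rfl))
      map_rel' := fun {n} r x => (hrel i hi _ (hind1 _) r _ _ (fun _ => rfl)).symm }
  let S : Ordinal.{u} → L.Substructure U := fun i =>
    if h : i < δ then (emb i h).toHom.range else ⊥
  have hS : ∀ i (h : i < δ), S i = (emb i h).toHom.range := fun i h => dif_pos h
  have hmem : ∀ i, i < δ → ∀ x : U, x ∈ S i ↔ (x : W) ∈ (f i).carrier := by
    intro i hi x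
    rw [hS i hi, Hom.mem_range]
    constructor
    · rintro ⟨y, rfl⟩
      exact y.2
    · intro hx
      exact ⟨⟨x, hx⟩, rfl⟩
  obtain ⟨hU, hstr⟩ := K.union_chain (M := U) δ hδ S (by
    intro i j hij hj
    have hi := hij.trans_lt hj
    refine ⟨fun x hx => ?_, ?_⟩
    · rw [hmem j hj]
      exact le_subset (hf i j hij hj) ((hmem i hi x).1 hx)
    · have h1 := K.strong_equiv (emb j hj).equivRange (incl (hf i j hij hj)).strong
      rw [hS j hj]
      convert h1 using 1
      ext ⟨x, hx⟩
      rw [Substructure.mem_comap, Substructure.mem_map]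
      constructor
      · intro hxi
        have hxi' : (x : W) ∈ (f i).carrier := (hmem i hi x).1 hxi
        refine ⟨incl (hf i j hij hj) ⟨x, hxi'⟩, Emb.mem_range.2 ⟨_, rfl⟩, ?_⟩
        apply Subtype.ext
        apply Subtype.ext
        exact coe_incl _ _
      · rintro ⟨y, hy, hyx⟩
        obtain ⟨z, rfl⟩ := Emb.mem_range.1 hy
        have h2 : ((incl (hf i j hij hj) z : (f j).carrier) : W) = x :=
          congrArg (fun t : (emb j hj).toHom.range => ((t : U) : W)) hyx
        rw [coe_incl] at h2
        refine (hmem i hi x).2 (h2 ▸ z.2)) (by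
    intro x
    obtain ⟨i, hi, hx⟩ := x.2
    exact ⟨i, hi, (hmem i hi x).2 hx⟩)
  refine ⟨⟨U, hU⟩, fun i hi => ⟨⟨emb i hi, ?_⟩, fun _ => rfl⟩, fun x => Iff.rfl⟩
  rw [← hS i hi]
  exact hstr i hi

end ModelOn

/-! ### Enumerations, regular lengths and a saturation criterion -/

variable {lam : Cardinal.{u}}

theorem card_le_of_lt_ord_succ {i : Ordinal.{u}} (h : i < (Order.succ lam).ord) : i.card ≤ lam :=
  Order.lt_succ_iff.1 (Cardinal.lt_ord.1 h)

theorem succ_lt_ord (hlam : ℵ₀ ≤ lam) {i : Ordinal.{u}} (h : i < lam.ord) :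
    Order.succ i < lam.ord :=
  (Cardinal.isSuccLimit_ord hlam).succ_lt h

/-- Galois types live one universe above the models, yet a bound by a lifted cardinal allows an
enumeration by ordinals of the lower universe. -/
theorem exists_ordinal_enumeration {X : Type (u + 1)} [Nonempty X]
    (h : #X ≤ Cardinal.lift.{u + 1} lam) :
    ∃ t : Ordinal.{u} → X, ∀ x, ∃ i < lam.ord, t i = x := by
  classical
  have h1 : Cardinal.lift.{u + 1} lam = #(ULift.{u + 1} lam.ord.ToType) := by simp
  rw [h1] at h
  obtain ⟨g⟩ := h
  let k : X → Ordinal.{u} := fun x => (Ordinal.ToType.mk.symm (g x).down : Set.Iio lam.ord)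
  have hk : Function.Injective k := by
    intro x y hxy
    apply g.injective
    apply ULift.down_injective
    exact Ordinal.ToType.mk.symm.injective (Subtype.ext hxy)
  exact ⟨Function.invFun k, fun x => ⟨k x, (Ordinal.ToType.mk.symm (g x).down).2,
    Function.leftInverse_invFun hk x⟩⟩

theorem exists_ordinal_enumeration' {X : Type u} [Nonempty X] (h : #X ≤ lam) :
    ∃ t : Ordinal.{u} → X, ∀ x, ∃ i < lam.ord, t i = x := by
  obtain ⟨t, ht⟩ := exists_ordinal_enumeration (X := ULift.{u + 1} X) (lam := lam) (by
    rw [Cardinal.mk_uLift]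
    exact Cardinal.lift_le.2 h)
  refine ⟨fun i => (t i).down, fun x => ?_⟩
  obtain ⟨i, hi, h⟩ := ht ⟨x⟩
  exact ⟨i, hi, congrArg ULift.down h⟩

/-- A small subset of a union of a chain of regular length is contained in a member. -/
theorem exists_index_of_regular {W : Type u} {κ : Cardinal.{u}} (hκ : κ.IsRegular)
    (C : Ordinal.{u} → Set W) (hC : ∀ i j, i ≤ j → j < κ.ord → C i ⊆ C j) (A : Set W)
    (hA : #A < κ) (hAC : ∀ x ∈ A, ∃ i < κ.ord, x ∈ C i) : ∃ i < κ.ord, A ⊆ C i := by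
  choose f hf using fun x : A => hAC x x.2
  have hs : iSup f < κ.ord :=
    Ordinal.iSup_lt_of_lt_cof (by rwa [hκ.cof_ord]) fun x => (hf x).1
  exact ⟨iSup f, hs, fun x hx =>
    hC _ _ (Ordinal.le_iSup f ⟨x, hx⟩) hs (hf ⟨x, hx⟩).2⟩

/-- A type over S extends by amalgamation to any model X containing S, so it suffices to realize the
types over one such X, whatever its size. -/
theorem saturated_of_exists {κ : Cardinal.{u}} {M : Type u} [L.Structure M] (hAP : K.Amalgamation)
    (hM : K.Mem M) (h : ∀ A : Set M, #A < κ → ∃ (X : Type u) (_ : L.Structure X) (f : K.Emb X M),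
      (∀ x ∈ A, ∃ y, f y = x) ∧ ∀ p : K.GaS X, ∃ a, galoisType f a = p) : K.Saturated κ M := by
  refine ⟨hM, fun S hS hc p => ?_⟩
  obtain ⟨X, _, f, hA, hf⟩ := h S hc
  obtain ⟨g, hg⟩ := Emb.lift f (Emb.incl hS) fun x => hA x x.2
  obtain ⟨q, rfl⟩ := p.exists_extension hAP g
  obtain ⟨a, rfl⟩ := hf q
  refine ⟨a, ?_⟩
  rw [comap_galoisType]
  congr 1
  exact (Emb.ext hg).symm

/-! ### Saturated extensions from stability -/

section SaturatedExtensions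

variable {W : Type u}

theorem ModelOn.galoisType_incl {m₁ m₂ m₃ : K.ModelOn W} (h₁₂ : m₁ ≤ m₂) (h₂₃ : m₂ ≤ m₃)
    (h₁₃ : m₁ ≤ m₃) (a : m₂.carrier) :
    galoisType (ModelOn.incl h₁₃) (ModelOn.incl h₂₃ a) = galoisType (ModelOn.incl h₁₂) a := by
  have : ModelOn.incl h₁₃ = (ModelOn.incl h₂₃).comp (ModelOn.incl h₁₂) :=
    Emb.ext fun x => Subtype.ext (by simp)
  rw [this, galoisType_comp]

theorem ModelOn.mk_union_le (hlam : ℵ₀ ≤ lam) {i : Ordinal.{u}} (hi : i.card ≤ lam)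
    {f : Ordinal.{u} → K.ModelOn W} (hf : ∀ j < i, #(f j).carrier ≤ lam) {m : K.ModelOn W}
    (hm : ∀ x, x ∈ m.carrier ↔ ∃ j < i, x ∈ (f j).carrier) : #m.carrier ≤ lam :=
  mk_biUnion_ordinal_le hlam hi (fun j => (f j).carrier) hf _ fun x hx => (hm x).1 hx

/-- Stability lists the types over `m₀` in order type `lam`. Each in turn is extended to the model
reached so far and realized there by an extension of size `lam`. -/
theorem ModelOn.exists_realizing (hAP : K.Amalgamation) (hLS : K.LS ≤ lam) (hst : K.Stable lam)
    (hW : #W = Order.succ lam) (m₀ : K.ModelOn W) (hm₀ : #m₀.carrier = lam) :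
    ∃ (m : K.ModelOn W) (h : m₀ ≤ m), #m.carrier = lam ∧
      ∀ p : K.GaS m₀.carrier, ∃ a, galoisType (ModelOn.incl h) a = p := by
  have hlam := aleph0_le_of_LS_le hLS
  have hne : Nonempty (K.GaS m₀.carrier) := by
    have : Nonempty m₀.carrier := by
      rw [← Cardinal.mk_ne_zero_iff, hm₀]
      exact (Cardinal.aleph0_pos.trans_le hlam).ne'
    exact ⟨galoisType (Emb.refl m₀.mem) this.some⟩
  obtain ⟨t, ht⟩ := exists_ordinal_enumeration (hst _ m₀.mem hm₀)
  obtain ⟨S, hS0, hSg, hSm, hSQ, -⟩ := exists_chain (P := K.ModelOn W) (fun m => m.carrier) lam.ord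
    (fun _ m => #m.carrier = lam)
    (fun i _ m' => ∀ h : m₀ ≤ m', ∃ a, galoisType (ModelOn.incl h) a = t i) m₀ hm₀
    (by
      intro i _ m h0 hm
      obtain ⟨q, hq⟩ := (t i).exists_extension hAP (ModelOn.incl h0)
      obtain ⟨N, _, f, a, hN, rfl⟩ := q.exists_small_rep hLS hm.le
      obtain ⟨m', e, he, hmm', hef⟩ := m.exists_extension hlam hW hm.le f hN
      have hc : #m'.carrier = lam := by
        apply le_antisymm
        · exact (Cardinal.mk_le_of_surjective he).trans hN
        · rw [← hm]
          exact Cardinal.mk_le_mk_of_subset (ModelOn.le_subset hmm')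
      refine ⟨m', hmm', hc, fun h => ⟨e a, ?_⟩⟩
      have h1 : ModelOn.incl h = e.comp (f.comp (ModelOn.incl h0)) :=
        Emb.ext fun x => Subtype.ext (by rw [ModelOn.coe_incl, Emb.comp_apply, Emb.comp_apply,
          hef, ModelOn.coe_incl])
      rw [h1, galoisType_comp, ← hq, comap_galoisType])
    (by
      intro i hi hl f h0 hf hc
      obtain ⟨m, hm1, hm2⟩ := ModelOn.exists_union hl f hf
      refine ⟨m, le_antisymm ?_ ?_, hm1, fun x hx => (hm2 x).1 hx⟩
      · exact ModelOn.mk_union_le hlam (card_le_of_le_ord hi) (fun j hj => (hc j hj).le) hm2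
      · rw [← hc 0 (isSuccLimit_pos hl)]
        exact Cardinal.mk_le_mk_of_subset (ModelOn.le_subset (hm1 0 (isSuccLimit_pos hl))))
  have h0 : ∀ i ≤ lam.ord, m₀ ≤ S i := fun i hi => hS0 ▸ hSm 0 i zero_le hi
  refine ⟨S lam.ord, h0 _ le_rfl, hSg _ le_rfl, fun p => ?_⟩
  obtain ⟨i, hi, rfl⟩ := ht p
  have hi' := (succ_lt_ord hlam hi).le
  obtain ⟨a, ha⟩ := hSQ i hi (h0 _ hi')
  exact ⟨ModelOn.incl (hSm _ _ hi' le_rfl) a, by rw [← ha, ModelOn.galoisType_incl (h0 _ hi')]⟩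

/-- In a stable cardinal, every model has a saturated extension. -/
theorem exists_saturated_extension (hAP : K.Amalgamation) (hLS : K.LS ≤ lam) (hst : K.Stable lam)
    {M : Type u} [L.Structure M] (hM : K.Mem M) (hc : #M = lam) :
    ∃ (C : Type u) (_ : L.Structure C) (_ : K.Emb M C), K.Saturated (Order.succ lam) C := by
  have hlam := aleph0_le_of_LS_le hLS
  obtain ⟨W, hW⟩ : ∃ W : Type u, #W = Order.succ lam := ⟨_, Cardinal.mk_out _⟩
  obtain ⟨m₀, e₀, he₀⟩ := ModelOn.exists_equiv (W := W) hM (by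
    rw [hc, hW]
    exact Order.le_succ _)
  have hm₀ : #m₀.carrier = lam :=
    hc ▸ (Cardinal.mk_congr (Equiv.ofBijective e₀ ⟨e₀.injective, he₀⟩)).symm
  have hreg : (Order.succ lam).IsRegular := Cardinal.isRegular_succ hlam
  -- The size requirement is dropped at the last stage `lam⁺`. By regularity every set of at most
  -- `lam` points lies in an earlier stage, all of whose types are realized at the next one.
  obtain ⟨S, hS0, hSg, hSm, hSQ, hSc⟩ := exists_chain (P := K.ModelOn W) (fun m => m.carrier)
    (Order.succ lam).ord (fun i m => i < (Order.succ lam).ord → #m.carrier = lam)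
    (fun i m m' => ∀ h : m ≤ m', ∀ p : K.GaS m.carrier, ∃ a, galoisType (ModelOn.incl h) a = p)
    m₀ (fun _ => hm₀)
    (by
      intro i hi m _ hm
      obtain ⟨m', h, hc', hr⟩ := ModelOn.exists_realizing hAP hLS hst hW m (hm hi)
      exact ⟨m', h, fun _ => hc', fun _ => hr⟩)
    (by
      intro i _ hl f h0 hf hc
      obtain ⟨m, hm1, hm2⟩ := ModelOn.exists_union hl f hf
      refine ⟨m, fun hi => le_antisymm ?_ ?_, hm1, fun x hx => (hm2 x).1 hx⟩
      · exact ModelOn.mk_union_le hlam (card_le_of_lt_ord_succ hi)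
          (fun j hj => (hc j hj (hj.trans hi)).le) hm2
      · rw [← hc 0 (isSuccLimit_pos hl) ((isSuccLimit_pos hl).trans hi)]
        exact Cardinal.mk_le_mk_of_subset (ModelOn.le_subset (hm1 0 (isSuccLimit_pos hl))))
  have hl := Cardinal.isSuccLimit_ord (hlam.trans (Order.le_succ lam))
  have h0 : m₀ ≤ S (Order.succ lam).ord := hS0 ▸ hSm 0 _ zero_le le_rfl
  refine ⟨(S (Order.succ lam).ord).carrier, _, (ModelOn.incl h0).comp e₀,
    saturated_of_exists hAP (ModelOn.mem _) fun A hA => ?_⟩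
  obtain ⟨i, hi, hAi⟩ := exists_index_of_regular hreg (fun i => (S i).carrier)
    (fun i j hij hj => ModelOn.le_subset (hSm i j hij hj.le)) (Subtype.val '' A)
    (Cardinal.mk_image_le.trans_lt hA) (by
      rintro _ ⟨x, _, rfl⟩
      exact hSc _ le_rfl hl x x.2)
  have hi1 := (succ_lt_ord (hlam.trans (Order.le_succ lam)) hi).le
  refine ⟨(S i).carrier, _, ModelOn.incl (hSm i _ hi.le le_rfl), fun x hx => ?_, fun p => ?_⟩
  · exact ⟨⟨x, hAi ⟨x, hx, rfl⟩⟩, Subtype.ext (by simp)⟩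
  · obtain ⟨a, ha⟩ := hSQ i hi (hSm _ _ (Order.le_succ i) hi1) p
    exact ⟨ModelOn.incl (hSm _ _ hi1 le_rfl) a, by
      rw [← ha, ModelOn.galoisType_incl (hSm _ _ (Order.le_succ i) hi1)]⟩

end SaturatedExtensions

/-! ### Universality and homogeneity of saturated models -/

/-- A stage in the construction of an embedding: a function on a domain, together with a further
parameter. -/
structure PartialMap (L : FirstOrder.Language.{u, u}) (B M W : Type u) [L.Structure M] where
  base : B
  dom : L.Substructure M
  toFun : M → W

instance {B M W : Type u} [L.Structure M] [Preorder B] : Preorder (PartialMap L B M W) where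
  le s t := s.base ≤ t.base ∧ s.dom ≤ t.dom ∧ ∀ x ∈ s.dom, s.toFun x = t.toFun x
  le_refl s := ⟨le_rfl, le_rfl, fun _ _ => rfl⟩
  le_trans := by
    rintro s t r ⟨h1, h2, h3⟩ ⟨k1, k2, k3⟩
    exact ⟨h1.trans k1, h2.trans k2, fun x hx => (h3 x hx).trans (k3 x (h2 hx))⟩

/-- Every strong extension of `X` of the same cardinality embeds in `M` over `X`, with image
contained in `Y`. -/
def UniversalWithin (K : AEC L) {M : Type u} [L.Structure M] (X Y : L.Substructure M) : Prop :=
  ∀ (D : Type u) [L.Structure D] (d : K.Emb X D), #D = #X →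
    ∃ h : K.Emb D M, (∀ y, h y ∈ Y) ∧ ∀ x : X, h (d x) = x

theorem mk_union_range_le {A B P : Type u} (hlam : ℵ₀ ≤ lam) (hA : #A ≤ lam) (hB : #B ≤ lam)
    (f : A → P) (g : B → P) : #(Set.range f ∪ Set.range g : Set P) ≤ lam :=
  (Cardinal.mk_union_le _ _).trans (Cardinal.add_le_of_le hlam
    (Cardinal.mk_range_le.trans hA) (Cardinal.mk_range_le.trans hB))

/-- Amalgamation of small models within a small model. -/
theorem exists_small_codomain (hLS : K.LS ≤ lam) {A B Z : Type u} [L.Structure A] [L.Structure B]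
    [L.Structure Z] (k : K.Emb A Z) (l : K.Emb B Z) (hA : #A ≤ lam) (hB : #B ≤ lam) :
    ∃ (Y : Type u) (_ : L.Structure Y) (j : K.Emb Y Z) (k' : K.Emb A Y) (l' : K.Emb B Y),
      #Y ≤ lam ∧ (∀ x, j (k' x) = k x) ∧ ∀ x, j (l' x) = l x := by
  obtain ⟨S, hS, hsub, hc⟩ := exists_strong_le hLS k.mem_cod (Set.range k ∪ Set.range l)
    (mk_union_range_le (aleph0_le_of_LS_le hLS) hA hB k l)
  obtain ⟨k', hk'⟩ := Emb.lift (Emb.incl hS) k fun x => ⟨⟨k x, hsub (Or.inl ⟨x, rfl⟩)⟩, rfl⟩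
  obtain ⟨l', hl'⟩ := Emb.lift (Emb.incl hS) l fun x => ⟨⟨l x, hsub (Or.inr ⟨x, rfl⟩)⟩, rfl⟩
  exact ⟨S, _, Emb.incl hS, k', l', hc, hk', hl'⟩

/-- The union of a chain of length `lam` of models of cardinality `lam`, each of which realizes the
types over its predecessors, is universal over the first member of the chain. -/
theorem universalWithin_of_chain (hAP : K.Amalgamation) (hLS : K.LS ≤ lam) {M : Type u}
    [L.Structure M] (S : Ordinal.{u} → L.Substructure M)
    (hS : ∀ i ≤ lam.ord, K.Strong (S i) ∧ #(S i) = lam)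
    (hmono : ∀ i j, i ≤ j → j ≤ lam.ord → S i ≤ S j)
    (hcont : ∀ i ≤ lam.ord, Order.IsSuccLimit i → ∀ x ∈ S i, ∃ j < i, x ∈ S j)
    (hreal : ∀ i < lam.ord, ∀ (hi : K.Strong (S i)) (p : K.GaS (S i)),
      ∃ a ∈ S (Order.succ i), galoisType (Emb.incl hi) a = p) :
    UniversalWithin K (S 0) (S lam.ord) := by
  classical
  intro D _ d hD
  have hlam := aleph0_le_of_LS_le hLS
  rw [(hS 0 zero_le).2] at hD
  obtain ⟨W, hW⟩ : ∃ W : Type u, #W = Order.succ lam := ⟨_, Cardinal.mk_out _⟩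
  obtain ⟨m₀, e₀, he₀⟩ := ModelOn.exists_equiv (W := W) d.mem_cod (by
    rw [hD, hW]
    exact Order.le_succ _)
  have hm₀ : #m₀.carrier = lam :=
    hD ▸ (Cardinal.mk_congr (Equiv.ofBijective e₀ ⟨e₀.injective, he₀⟩)).symm
  have hne : Nonempty m₀.carrier := by
    rw [← Cardinal.mk_ne_zero_iff, hm₀]
    exact (Cardinal.aleph0_pos.trans_le hlam).ne'
  have hneW : Nonempty W := ⟨(hne.some : W)⟩
  obtain ⟨a, ha⟩ := exists_ordinal_enumeration' hm₀.le
  let F₀ : M → W := fun x => if h : x ∈ S 0 then e₀ (d ⟨x, h⟩) else hneW.some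
  have hF₀ : ∀ x : S 0, F₀ x = e₀ (d x) := fun x => dif_pos x.2
  -- The embedding is built backwards: the `S i` are mapped into growing extensions of a copy `m₀`
  -- of D, and stage i puts the i-th element of `m₀` into the image. In the end the image contains
  -- `m₀`, and inverting gives D inside the union.
  obtain ⟨s, hs0, hsg, hsm, hsQ, -⟩ := exists_chain (P := PartialMap L (K.ModelOn W) M W)
    (fun s => s.base.carrier) lam.ord
    (fun i s => s.dom = S i ∧ #s.base.carrier ≤ lam ∧
      ∃ f : K.Emb (S i) s.base.carrier, ∀ x, (f x : W) = s.toFun x)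
    (fun i _ s' => ∃ x ∈ s'.dom, s'.toFun x = a i) ⟨m₀, S 0, F₀⟩
    ⟨rfl, hm₀.le, e₀.comp d, fun x => (hF₀ x).symm⟩
    (by
      rintro i hi ⟨m, A, F⟩ ⟨hm, -, -⟩ ⟨hA, hmc, f, hf⟩
      dsimp only at hA hmc f hf hm ⊢
      have hi' : Order.succ i ≤ lam.ord := (succ_lt_ord hlam hi).le
      have hle := hmono i _ (Order.le_succ i) hi'
      let y : m.carrier := ModelOn.incl hm (a i)
      -- The next model realizes the type of y over `S i`, taken along f, by some b; equality of
      -- types provides an amalgam in which b and y coincide.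
      obtain ⟨b, hb, hbt⟩ := hreal i hi (hS i hi.le).1 (galoisType f y)
      obtain ⟨j, hj⟩ := exists_inclusion (hS i hi.le).1 (hS _ hi').1 hle
      have hbt' : galoisType j (⟨b, hb⟩ : S (Order.succ i)) = galoisType f y := by
        rw [← hbt, ← galoisType_comp (Emb.incl (hS _ hi').1) j]
        congr 1
        exact Emb.ext hj
      obtain ⟨Z, _, k, l, hkl, hkb⟩ := (galoisType_eq_iff hAP).1 hbt'
      obtain ⟨Y, _, v, k', l', hY, hk', hl'⟩ := exists_small_codomain hLS k l (hS _ hi').2.le hmc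
      have hkl' : ∀ x, k' (j x) = l' (f x) := fun x => v.injective (by rw [hk', hl', hkl])
      have hkb' : k' ⟨b, hb⟩ = l' y := v.injective (by rw [hk', hl', hkb])
      obtain ⟨m', e, he, hmm', hel⟩ := m.exists_extension hlam hW hmc l' hY
      let F' : M → W := fun x => if h : x ∈ S (Order.succ i) then e (k' ⟨x, h⟩) else F x
      have hF' : ∀ x : S (Order.succ i), F' x = e (k' x) := fun x => dif_pos x.2
      refine ⟨⟨m', S (Order.succ i), F'⟩, ⟨hmm', ?_, ?_⟩, ⟨rfl, ?_, e.comp k', ?_⟩, ⟨b, hb, ?_⟩⟩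
      · rw [hA]
        exact hle
      · intro x hx
        rw [hA] at hx
        have h1 := hF' (j ⟨x, hx⟩)
        rw [hj, hkl', hel] at h1
        exact (h1.trans (hf ⟨x, hx⟩)).symm
      · exact (Cardinal.mk_le_of_surjective he).trans hY
      · exact fun x => (hF' x).symm
      · refine (hF' ⟨b, hb⟩).trans ?_
        rw [hkb', hel]
        exact ModelOn.coe_incl hm (a i))
    (by
      intro i hi hl s hs0 hsm hsg
      obtain ⟨m, hm1, hm2⟩ := ModelOn.exists_union hl (fun j => (s j).base)
        (fun j k hjk hk => (hsm j k hjk hk).1)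
      obtain ⟨G, hG⟩ := exists_glued_function (fun j => (S j : Set M)) (fun j => (s j).toFun)
        (δ := i) (by
          intro j k hjk hk x hx
          rw [← (hsg j (hjk.trans_lt hk)).1] at hx
          exact (hsm j k hjk hk).2.2 x hx)
      have hU : ∀ x, x ∈ S i ↔ ∃ j < i, x ∈ S j :=
        fun x => ⟨hcont i hi hl x, fun ⟨j, hj, hx⟩ => hmono j i hj.le hi hx⟩
      have hGm : ∀ x ∈ S i, G x ∈ m.carrier := by
        intro x hx
        obtain ⟨j, hj, hx⟩ := (hU x).1 hx
        obtain ⟨-, -, f, hf⟩ := hsg j hj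
        rw [hG j hj x hx, ← hf ⟨x, hx⟩]
        exact ModelOn.le_subset (hm1 j hj) (f _).2
      obtain ⟨g, hg⟩ := exists_emb_union (N := m.carrier) hl S (S i)
        (fun j k hjk hk => hmono j k hjk (hk.le.trans hi)) hU (fun x => ⟨G x, hGm x x.2⟩) (by
          intro j hj
          obtain ⟨-, -, f, hf⟩ := hsg j hj
          refine ⟨(ModelOn.incl (hm1 j hj)).comp f, fun x hx _ => Subtype.ext ?_⟩
          rw [Emb.comp_apply, ModelOn.coe_incl, hf]
          exact (hG j hj x hx).symm)
      refine ⟨⟨m, S i, G⟩, ⟨rfl, ?_, g, fun x => by rw [hg]⟩, fun j hj => ⟨hm1 j hj, ?_, ?_⟩,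
        fun x hx => (hm2 x).1 hx⟩
      · exact ModelOn.mk_union_le hlam (card_le_of_le_ord hi) (fun j hj => (hsg j hj).2.1) hm2
      · rw [(hsg j hj).1]
        exact hmono j i hj.le hi
      · intro x hx
        rw [(hsg j hj).1] at hx
        exact (hG j hj x hx).symm)
  obtain ⟨-, -, f, hf⟩ := hsg lam.ord le_rfl
  have h0 := hsm 0 lam.ord zero_le le_rfl
  rw [hs0] at h0
  obtain ⟨h0m, -, h0F⟩ := h0
  dsimp only at h0m h0F
  obtain ⟨g, hg⟩ := Emb.lift f ((ModelOn.incl h0m).comp e₀) (by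
    intro y
    obtain ⟨i, hi, hai⟩ := ha (e₀ y)
    have hi' := (succ_lt_ord hlam hi).le
    obtain ⟨x, hx, hxa⟩ := hsQ i hi
    have hxS : x ∈ S lam.ord := by
      rw [(hsg _ hi').1] at hx
      exact hmono _ _ hi' le_rfl hx
    refine ⟨⟨x, hxS⟩, Subtype.ext ?_⟩
    rw [hf, Emb.comp_apply, ModelOn.coe_incl, ← hai, ← hxa]
    exact ((hsm _ _ hi' le_rfl).2.2 x hx).symm)
  refine ⟨(Emb.incl (hS _ le_rfl).1).comp g, fun y => (g y).2, fun x => ?_⟩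
  have hxS : (x : M) ∈ S lam.ord := hmono 0 _ zero_le le_rfl x.2
  have : g (d x) = ⟨x, hxS⟩ := by
    apply f.injective
    apply Subtype.ext
    rw [hg, hf, Emb.comp_apply, ModelOn.coe_incl, ← hF₀]
    exact h0F x x.2
  rw [Emb.comp_apply, this]
  rfl

/-- Increasing continuous chains of strong substructures of cardinality `lam`. -/
theorem exists_substructure_chain (hlam : ℵ₀ ≤ lam) {M : Type u} [L.Structure M]
    (X₀ : L.Substructure M) (hX₀ : K.Strong X₀) (hc : #X₀ = lam) (δ : Ordinal.{u})
    (hδ : δ.card ≤ lam) (Q : Ordinal.{u} → L.Substructure M → L.Substructure M → Prop)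
    (step : ∀ i X, K.Strong X → #X = lam → X₀ ≤ X →
      ∃ Y, X ≤ Y ∧ (K.Strong Y ∧ #Y = lam) ∧ Q i X Y) :
    ∃ S : Ordinal.{u} → L.Substructure M, S 0 = X₀ ∧ (∀ i ≤ δ, K.Strong (S i) ∧ #(S i) = lam) ∧
      (∀ i j, i ≤ j → j ≤ δ → S i ≤ S j) ∧ (∀ i < δ, Q i (S i) (S (Order.succ i))) ∧
      ∀ i ≤ δ, Order.IsSuccLimit i → ∀ x ∈ S i, ∃ j < i, x ∈ S j := by
  refine exists_chain (P := L.Substructure M) (fun X => (X : Set M)) δ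
    (fun _ X => K.Strong X ∧ #X = lam) Q X₀ ⟨hX₀, hc⟩ (fun i _ X h0 hX => step i X hX.1 hX.2 h0) ?_
  intro i hi hl f h0 hf hg
  have hpos := isSuccLimit_pos hl
  obtain ⟨U, hU⟩ := exists_substructure_union hpos f hf
  have hle : ∀ j < i, f j ≤ U := fun j hj x hx => (hU x).2 ⟨j, hj, hx⟩
  refine ⟨U, ⟨?_, le_antisymm ?_ ?_⟩, hle, fun x hx => (hU x).1 hx⟩
  · exact K.union_strong i hl f U hf (fun j hj => (hg j hj).1) hU
  · exact mk_biUnion_ordinal_le hlam ((Ordinal.card_le_card hi).trans hδ)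
      (fun j => (f j : Set M)) (fun j hj => (hg j hj).2.le) U fun x hx => (hU x).1 hx
  · rw [← (hg 0 hpos).2]
    exact Cardinal.mk_le_mk_of_subset (hle 0 hpos)

/-- By stability one realization of each type over X adds at most `lam` points, so Löwenheim–Skolem
still gives a model of size `lam`. -/
theorem exists_realizing_within (hLS : K.LS ≤ lam) (hst : K.Stable lam) {M : Type u}
    [L.Structure M] (hM : K.Saturated (Order.succ lam) M) (X : L.Substructure M)
    (hX : K.Strong X) (hc : #X = lam) : ∃ Y, X ≤ Y ∧ (K.Strong Y ∧ #Y = lam) ∧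
      ∀ (hX : K.Strong X) (p : K.GaS X), ∃ a ∈ Y, galoisType (Emb.incl hX) a = p := by
  have hr := hM.2 X hX (hc ▸ Order.lt_succ _)
  choose r hr using hr
  have h1 : #(Set.range r) ≤ lam := by
    have := (Cardinal.mk_range_le_lift (f := r)).trans
      (Cardinal.lift_le.2 (hst X (K.mem_of_strong hX).1 hc))
    have h2 : Cardinal.lift.{u + 1} #(Set.range r) ≤ Cardinal.lift.{u + 1} lam := by
      simpa using this
    exact Cardinal.lift_le.1 h2
  obtain ⟨Y, hY, hsub, hYc⟩ := exists_strong_eq hLS hM.1 (hc ▸ Cardinal.mk_set_le (X : Set M))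
    ((X : Set M) ∪ Set.range r) ((Cardinal.mk_union_le _ _).trans
      (Cardinal.add_le_of_le (aleph0_le_of_LS_le hLS) hc.le h1))
  exact ⟨Y, fun x hx => hsub (Or.inl hx), ⟨hY, hYc⟩, fun _ p => ⟨r p, hsub (Or.inr ⟨p, rfl⟩), hr p⟩⟩

/-- Universal extensions exist inside saturated models. -/
theorem exists_universalWithin (hAP : K.Amalgamation) (hLS : K.LS ≤ lam) (hst : K.Stable lam)
    {M : Type u} [L.Structure M] (hM : K.Saturated (Order.succ lam) M) (X : L.Substructure M)
    (hX : K.Strong X) (hc : #X = lam) : ∃ Y, X ≤ Y ∧ (K.Strong Y ∧ #Y = lam) ∧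
      UniversalWithin K X Y ∧
      ∀ (hX : K.Strong X) (p : K.GaS X), ∃ a ∈ Y, galoisType (Emb.incl hX) a = p := by
  have hlam := aleph0_le_of_LS_le hLS
  obtain ⟨S, hS0, hS, hm, hQ, hcont⟩ := exists_substructure_chain hlam X hX hc lam.ord
    (card_le_of_le_ord le_rfl) (fun _ X Y => ∀ (hX : K.Strong X) (p : K.GaS X), ∃ a ∈ Y,
      galoisType (Emb.incl hX) a = p)
    (fun _ X hX hc _ => exists_realizing_within hLS hst hM X hX hc)
  have hpos := isSuccLimit_pos (Cardinal.isSuccLimit_ord hlam)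
  have hu := universalWithin_of_chain hAP hLS S hS hm hcont hQ
  have hr := hQ 0 hpos
  rw [hS0] at hu hr
  refine ⟨S lam.ord, hS0 ▸ hm 0 _ zero_le le_rfl, hS _ le_rfl, hu, fun hX p => ?_⟩
  obtain ⟨a, ha, hap⟩ := hr hX p
  exact ⟨a, hm _ _ (succ_lt_ord hlam hpos).le le_rfl ha, hap⟩

/-- Saturated models are model homogeneous. -/
theorem Saturated.exists_emb (hAP : K.Amalgamation) (hLS : K.LS ≤ lam) (hst : K.Stable lam)
    {M : Type u} [L.Structure M] (hM : K.Saturated (Order.succ lam) M) {A D : Type u}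
    [L.Structure A] [L.Structure D] (f : K.Emb A M) (d : K.Emb A D) (hA : #A = lam)
    (hD : #D = lam) : ∃ h : K.Emb D M, ∀ x, h (d x) = f x := by
  have hc : #f.range = lam := f.mk_card_range.trans hA
  obtain ⟨Y, -, -, hY, -⟩ := exists_universalWithin hAP hLS hst hM f.range f.strong hc
  obtain ⟨g, hg⟩ := Emb.lift f (Emb.incl f.strong) fun y => Emb.mem_range.1 y.2
  obtain ⟨h, -, hh⟩ := hY D (d.comp g) (hD.trans hc.symm)
  refine ⟨h, fun x => ?_⟩
  have h1 := hh ⟨f x, Emb.mem_range.2 ⟨x, rfl⟩⟩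
  have h2 : g ⟨f x, Emb.mem_range.2 ⟨x, rfl⟩⟩ = x := f.injective (hg _)
  rwa [Emb.comp_apply, h2] at h1

/-! ### Limit models inside saturated models -/

section LimitModels

/-- `N` is the union of a chain of substructures of `M` witnessing that it is a limit model. -/
def LimitWithin (K : AEC L) (lam : Cardinal.{u}) (θ : Ordinal.{u}) {M : Type u} [L.Structure M]
    (N : L.Substructure M) : Prop :=
  ∃ S : Ordinal.{u} → L.Substructure M, (∀ i < θ, K.Strong (S i) ∧ #(S i) = lam) ∧
    (∀ i j, i ≤ j → j < θ → S i ≤ S j) ∧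
    (∀ i < θ, Order.IsSuccLimit i → ∀ x ∈ S i, ∃ j < i, x ∈ S j) ∧
    (∀ i, Order.succ i < θ → UniversalWithin K (S i) (S (Order.succ i))) ∧
    ∀ x, x ∈ N ↔ ∃ i < θ, x ∈ S i

variable {M X : Type u} [L.Structure M] [L.Structure X]

theorem Emb.mk_comap (f : K.Emb X M) {T : L.Substructure M} (h : ∀ y ∈ T, ∃ x, f x = y) :
    #(T.comap f.toEmbedding.toHom) = #T := by
  refine Cardinal.mk_congr (Equiv.ofBijective (fun x => ⟨f x, x.2⟩) ⟨fun x y hxy => ?_, ?_⟩)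
  · exact Subtype.ext (f.injective (congrArg Subtype.val hxy))
  · rintro ⟨y, hy⟩
    obtain ⟨x, rfl⟩ := h y hy
    exact ⟨⟨x, hy⟩, rfl⟩

theorem Emb.strongIn_comap (f : K.Emb X M) {S T : L.Substructure M} (hS : K.Strong S)
    (hT : K.Strong T) (hST : S ≤ T) (h : ∀ y ∈ T, ∃ x, f x = y) :
    K.StrongIn (S.comap f.toEmbedding.toHom) (T.comap f.toEmbedding.toHom) :=
  strongIn_of_le (f.strong_comap hS fun y hy => h y (hST hy)) (f.strong_comap hT h)
    fun _ hx => hST hx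

/-- Passes from embeddings into M with image in T to the intrinsic notion: such an embedding factors
through the preimage of T by coherence. -/
theorem Emb.universalIn_comap (f : K.Emb X M) {S T : L.Substructure M} (hS : K.Strong S)
    (hT : K.Strong T) (hST : S ≤ T) (h : ∀ y ∈ T, ∃ x, f x = y) (hu : UniversalWithin K S T) :
    K.UniversalIn (S.comap f.toEmbedding.toHom) (T.comap f.toEmbedding.toHom) := by
  have hsi := f.strongIn_comap hS hT hST h
  have hT' := f.strong_comap hT h
  refine ⟨hsi.1, hsi.2, fun N _ d hN => ?_⟩
  let g := f.comp (Emb.incl hT')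
  obtain ⟨k, hk⟩ := Emb.lift (Emb.incl hS) (g.comp (Emb.incl hsi.2)) fun x => ⟨⟨f x, x.2⟩, rfl⟩
  have hks : Function.Surjective k := by
    rintro ⟨y, hy⟩
    obtain ⟨x, rfl⟩ := h y (hST hy)
    exact ⟨⟨⟨x, hST hy⟩, hy⟩, Subtype.ext (hk _)⟩
  obtain ⟨k', hk', -⟩ := k.exists_inv hks
  obtain ⟨e, he, he'⟩ := hu N (d.comp k')
    (hN.trans (Cardinal.mk_congr (Equiv.ofBijective k ⟨k.injective, hks⟩)))
  obtain ⟨w, hw⟩ := Emb.lift g e fun y => by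
    obtain ⟨x, hx⟩ := h _ (he y)
    exact ⟨⟨x, show f x ∈ T from hx ▸ he y⟩, hx⟩
  refine ⟨w, fun x => g.injective ?_⟩
  rw [hw]
  have := he' (k x)
  rw [Emb.comp_apply, hk'] at this
  rw [this]
  exact hk x

theorem LimitWithin.isLimit {θ : Ordinal.{u}} {N : L.Substructure M} (hN : LimitWithin K lam θ N)
    (f : K.Emb X M) (hf : ∀ y, y ∈ N ↔ ∃ x, f x = y) : K.IsLimit lam θ X := by
  obtain ⟨S, hS, hm, hc, hu, hSN⟩ := hN
  have hr : ∀ i < θ, ∀ y ∈ S i, ∃ x, f x = y := fun i hi y hy => (hf y).1 ((hSN y).2 ⟨i, hi, hy⟩)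
  refine ⟨fun i => (S i).comap f.toEmbedding.toHom, fun i hi => ?_, fun i j hij hj => ?_,
    fun i hi hl x hx => hc i hi hl _ hx, fun i hi => ?_, fun x => ?_⟩
  · rw [f.mk_comap (hr i hi), (hS i hi).2]
  · exact f.strongIn_comap (hS i (hij.trans_lt hj)).1 (hS j hj).1 (hm i j hij hj) (hr j hj)
  · have hi' := (Order.le_succ i).trans_lt hi
    exact f.universalIn_comap (hS i hi').1 (hS _ hi).1 (hm _ _ (Order.le_succ i) hi) (hr _ hi)
      (hu i hi)
  · exact (hSN (f x)).1 ((hf _).2 ⟨x, rfl⟩)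

theorem Saturated.of_surjective {κ : Cardinal.{u}} (hX : K.Saturated κ X) (f : K.Emb X M)
    (hf : Function.Surjective f) : K.Saturated κ M := by
  refine ⟨f.mem_cod, fun S hS hc p => ?_⟩
  have hr : ∀ y ∈ S, ∃ x, f x = y := fun y _ => hf y
  have hS' := f.strong_comap hS hr
  obtain ⟨k, hk⟩ := Emb.lift (Emb.incl hS) (f.comp (Emb.incl hS')) fun x => ⟨⟨f x, x.2⟩, rfl⟩
  have hks : Function.Surjective k := by
    rintro ⟨y, hy⟩
    obtain ⟨x, rfl⟩ := hf y
    exact ⟨⟨x, hy⟩, Subtype.ext (hk _)⟩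
  obtain ⟨k', hk1, hk2⟩ := k.exists_inv hks
  obtain ⟨a, ha⟩ := hX.2 _ hS' (by rwa [f.mk_comap hr]) (p.comap k)
  refine ⟨f a, ?_⟩
  have h1 : (p.comap k).comap k' = p := by
    rw [GaS.comap_comap]
    have : k.comp k' = Emb.refl (K.mem_of_strong hS).1 := Emb.ext hk2
    rw [this, GaS.comap_refl]
  rw [← h1, ← ha, comap_galoisType, ← galoisType_comp f]
  congr 1
  refine Emb.ext fun y => ?_
  rw [Emb.comp_apply, Emb.comp_apply, ← Emb.comp_apply f, ← hk, hk2]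

/-- Chains of universal extensions inside saturated models. -/
theorem exists_universal_chain (hAP : K.Amalgamation) (hLS : K.LS ≤ lam) (hst : K.Stable lam)
    (hM : K.Saturated (Order.succ lam) M) (Y : L.Substructure M) (hY : K.Strong Y)
    (hc : #Y = lam) : ∃ N : L.Substructure M, Y ≤ N ∧ (K.Strong N ∧ #N = lam) ∧
      UniversalWithin K Y N ∧ LimitWithin K lam lam.ord N ∧
      (lam.IsRegular → K.Saturated lam N) := by
  have hlam := aleph0_le_of_LS_le hLS
  have hl := Cardinal.isSuccLimit_ord hlam
  obtain ⟨S, rfl, hS, hm, hQ, hcont⟩ := exists_substructure_chain hlam Y hY hc lam.ord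
    (card_le_of_le_ord le_rfl) (fun _ X Y => UniversalWithin K X Y ∧
      ∀ (hX : K.Strong X) (p : K.GaS X), ∃ a ∈ Y, galoisType (Emb.incl hX) a = p)
    (fun _ X hX hc _ => exists_universalWithin hAP hLS hst hM X hX hc)
  have hpos := isSuccLimit_pos hl
  refine ⟨S lam.ord, hm 0 _ zero_le le_rfl, hS _ le_rfl, ?_, ?_, fun hreg => ?_⟩
  · intro D _ d hD
    obtain ⟨e, he, he'⟩ := (hQ 0 hpos).1 D d hD
    exact ⟨e, fun y => hm _ _ (hl.succ_lt hpos).le le_rfl (he y), he'⟩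
  · refine ⟨S, fun i hi => hS i hi.le, fun i j hij hj => hm i j hij hj.le,
      fun i hi => hcont i hi.le, fun i hi => (hQ i ((Order.le_succ i).trans_lt hi)).1,
      fun x => ⟨hcont _ le_rfl hl x, fun ⟨i, hi, hx⟩ => hm i _ hi.le le_rfl hx⟩⟩
  -- For regular `lam` a set of fewer than `lam` points is contained in one stage, and the next
  -- stage realizes all types over it.
  · have hN := (hS _ le_rfl).1
    refine saturated_of_exists hAP (K.mem_of_strong hN).1 fun A hA => ?_
    obtain ⟨i, hi, hAi⟩ := exists_index_of_regular hreg (fun i => (S i : Set M))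
      (fun i j hij hj => hm i j hij hj.le) (Subtype.val '' A) (Cardinal.mk_image_le.trans_lt hA)
      (by
        rintro _ ⟨x, -, rfl⟩
        exact hcont _ le_rfl hl x x.2)
    have hi' := (hS i hi.le).1
    refine ⟨S i, _, inclLE hi' hN (hm _ _ hi.le le_rfl), fun x hx => ?_, fun p => ?_⟩
    · exact ⟨⟨x, hAi ⟨x, hx, rfl⟩⟩, Subtype.ext (by simp)⟩
    · obtain ⟨a, ha, rfl⟩ := (hQ i hi).2 hi' p
      refine ⟨⟨a, hm _ _ (hl.succ_lt hi).le le_rfl ha⟩, ?_⟩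
      rw [← galoisType_comp (Emb.incl hN)]
      congr 1
      exact Emb.ext fun x => by simp

theorem LimitWithin.isLimitModel (hlam : ℵ₀ ≤ lam) {N : L.Substructure M}
    (hN : LimitWithin K lam lam.ord N) (f : K.Emb X M) (hf : ∀ y, y ∈ N ↔ ∃ x, f x = y) :
    K.IsLimitModel lam X :=
  ⟨lam.ord, Cardinal.isSuccLimit_ord hlam, Cardinal.ord_lt_ord.2 (Order.lt_succ lam),
    hN.isLimit f hf⟩

/-- Universality is inherited by smaller bases of the same cardinality. -/
theorem UniversalWithin.mono_left (hAP : K.Amalgamation) (hLS : K.LS ≤ lam)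
    {S T Y : L.Substructure M} (hS : K.Strong S) (hT : K.Strong T) (hST : S ≤ T)
    (hSc : #S = lam) (hTc : #T = lam) (h : UniversalWithin K T Y) : UniversalWithin K S Y := by
  intro D _ d hD
  -- An amalgam of D and T over S, cut down to size `lam`, is an extension of T, to which
  -- universality over T applies.
  obtain ⟨Z, _, k, l, hkl⟩ := hAP S D T d (inclLE hS hT hST)
  obtain ⟨V, _, j, k', l', hV, hk', hl'⟩ :=
    exists_small_codomain hLS k l (hD.trans hSc).le hTc.le
  have hVc : #V = #T := le_antisymm (hV.trans hTc.ge) (Cardinal.mk_le_of_injective l'.injective)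
  obtain ⟨e, he, he'⟩ := h V l' hVc
  refine ⟨e.comp k', fun y => he _, fun x => ?_⟩
  have h1 : k' (d x) = l' (inclLE hS hT hST x) := j.injective (by rw [hk', hl', hkl])
  rw [Emb.comp_apply, h1, he', coe_inclLE]

end LimitModels

/-- A model of cardinality at most `lam⁺` embeds in a `lam⁺`-saturated model over a common submodel
of cardinality `lam`. -/
theorem Saturated.exists_emb_succ (hAP : K.Amalgamation) (hLS : K.LS ≤ lam) (hst : K.Stable lam)
    {M X B : Type u} [L.Structure M] [L.Structure X] [L.Structure B]
    (hM : K.Saturated (Order.succ lam) M) (f : K.Emb B M) (d : K.Emb B X) (hB : #B = lam)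
    (hX : #X ≤ Order.succ lam) : ∃ h : K.Emb X M, ∀ x, h (d x) = f x := by
  classical
  have hlam := aleph0_le_of_LS_le hLS
  have hlam' := hlam.trans (Order.le_succ lam)
  have hne : Nonempty B := by
    rw [← Cardinal.mk_ne_zero_iff, hB]
    exact (Cardinal.aleph0_pos.trans_le hlam).ne'
  have : Nonempty X := ⟨d hne.some⟩
  have hneM : Nonempty M := ⟨f hne.some⟩
  obtain ⟨a, ha⟩ := exists_ordinal_enumeration' hX
  obtain ⟨g₀, hg₀⟩ := Emb.lift d (Emb.incl d.strong) fun y => Emb.mem_range.1 y.2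
  let F₀ : X → M := fun x => if h : x ∈ d.range then f (g₀ ⟨x, h⟩) else hneM.some
  have hF₀ : ∀ x : d.range, F₀ x = f (g₀ x) := fun x => dif_pos x.2
  -- X is exhausted in `lam⁺` steps by submodels of size `lam`, each mapped into M by homogeneity.
  -- The extra parameter is trivial, and the last domain, all of X, is exempt from the size bound.
  obtain ⟨s, hs0, hsg, hsm, hsQ, hsc⟩ := exists_chain (P := PartialMap L PUnit.{u + 1} X M)
    (fun s => (s.dom : Set X)) (Order.succ lam).ord
    (fun i s => (i < (Order.succ lam).ord → #s.dom = lam) ∧ K.Strong s.dom ∧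
      ∃ f : K.Emb s.dom M, ∀ x, f x = s.toFun x)
    (fun i _ s' => a i ∈ s'.dom) ⟨⟨⟩, d.range, F₀⟩
    ⟨fun _ => d.mk_card_range.trans hB, d.strong, f.comp g₀, fun x => (hF₀ x).symm⟩
    (by
      rintro i hi ⟨_, Y, F⟩ _ ⟨hYc, hY, g, hg⟩
      replace hYc := hYc hi
      dsimp only at hYc hY g hg ⊢
      obtain ⟨Y', hY', hsub, hYc'⟩ := exists_strong_eq hLS d.mem_cod
        (hYc ▸ Cardinal.mk_set_le (Y : Set X)) ((Y : Set X) ∪ {a i})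
        ((Cardinal.mk_union_le _ _).trans (Cardinal.add_le_of_le hlam hYc.le
          ((Cardinal.mk_singleton _).trans_le (Cardinal.one_lt_aleph0.le.trans hlam))))
      have hle : Y ≤ Y' := fun x hx => hsub (Or.inl hx)
      obtain ⟨h, hh⟩ := hM.exists_emb hAP hLS hst g (inclLE hY hY' hle) hYc hYc'
      let F' : X → M := fun x => if hx : x ∈ Y' then h ⟨x, hx⟩ else F x
      have hF' : ∀ x : Y', F' x = h x := fun x => dif_pos x.2
      refine ⟨⟨⟨⟩, Y', F'⟩, ⟨le_rfl, hle, fun x hx => ?_⟩,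
        ⟨fun _ => hYc', hY', h, fun x => (hF' x).symm⟩, hsub (Or.inr rfl)⟩
      have h1 := hF' (inclLE hY hY' hle ⟨x, hx⟩)
      rw [coe_inclLE, hh, hg] at h1
      exact h1.symm)
    (by
      intro i hi hl s hs0 hsm hsg
      have hpos := isSuccLimit_pos hl
      obtain ⟨U, hU⟩ := exists_substructure_union hpos (fun j => (s j).dom)
        (fun j k hjk hk => (hsm j k hjk hk).2.1)
      have hle : ∀ j < i, (s j).dom ≤ U := fun j hj x hx => (hU x).2 ⟨j, hj, hx⟩
      obtain ⟨G, hG⟩ := exists_glued_function (fun j => ((s j).dom : Set X))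
        (fun j => (s j).toFun) (δ := i) (fun j k hjk hk x hx => (hsm j k hjk hk).2.2 x hx)
      obtain ⟨g, hg⟩ := exists_emb_union (N := M) hl (fun j => (s j).dom) U
        (fun j k hjk hk => (hsm j k hjk hk).2.1) hU (fun x => G x) (by
          intro j hj
          obtain ⟨-, -, f, hf⟩ := hsg j hj
          refine ⟨f, fun x hx _ => ?_⟩
          rw [hf]
          exact (hG j hj x hx).symm)
      refine ⟨⟨⟨⟩, U, G⟩, ⟨fun hi => le_antisymm ?_ ?_, ?_, g, hg⟩,
        fun j hj => ⟨le_rfl, hle j hj, fun x hx => (hG j hj x hx).symm⟩,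
        fun x hx => (hU x).1 hx⟩
      · exact mk_biUnion_ordinal_le hlam (card_le_of_lt_ord_succ hi)
          (fun j => ((s j).dom : Set X)) (fun j hj => ((hsg j hj).1 (hj.trans hi)).le) U
          fun x hx => (hU x).1 hx
      · rw [← (hsg 0 hpos).1 (hpos.trans hi)]
        exact Cardinal.mk_le_mk_of_subset (hle 0 hpos)
      · exact K.union_strong i hl (fun j => (s j).dom) U
          (fun j k hjk hk => (hsm j k hjk hk).2.1) (fun j hj => (hsg j hj).2.1) hU)
  obtain ⟨-, hY, g, hg⟩ := hsg _ le_rfl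
  have htop : ∀ x, x ∈ (s (Order.succ lam).ord).dom := by
    intro x
    obtain ⟨i, hi, rfl⟩ := ha x
    exact (hsm _ _ (succ_lt_ord hlam' hi).le le_rfl).2.1 (hsQ i hi)
  obtain ⟨w, hw⟩ := Emb.lift (Emb.incl hY) (Emb.refl d.mem_cod) fun x => ⟨⟨x, htop x⟩, rfl⟩
  refine ⟨g.comp w, fun b => ?_⟩
  have h0 := (hsm 0 _ zero_le le_rfl).2.2
  rw [hs0] at h0
  have hb : d b ∈ d.range := Emb.mem_range.2 ⟨b, rfl⟩
  have h1 := h0 (d b) hb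
  have h2 : ((w (d b) : (s (Order.succ lam).ord).dom) : X) = d b := hw (d b)
  have h3 : g₀ ⟨d b, hb⟩ = b := d.injective (hg₀ _)
  rw [Emb.comp_apply, hg, h2, ← h1]
  exact (hF₀ ⟨d b, hb⟩).trans (by rw [h3])

variable {μ : Cardinal.{u}}

/-! ### Non-splitting: uniqueness and existence of extensions -/

section NonSplitting

variable {A B C D M : Type u} [L.Structure A] [L.Structure B] [L.Structure C] [L.Structure D]
  [L.Structure M]

/-- Non-`μ`-splitting of a type over the image of a `K`-embedding, in terms of embeddings. -/
def NonSplit (μ : Cardinal.{u}) (a : K.Emb A M) (p : K.GaS M) : Prop :=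
  ∀ (X : Type u) [L.Structure X] (f₁ f₂ : K.Emb X M) (g : K.Emb A X), #X = μ →
    (∀ x, f₁ (g x) = a x) → (∀ x, f₂ (g x) = a x) → p.comap f₁ = p.comap f₂

/-- If the pull-backs along f₁ and f₂ differed, the isomorphism f₂ ∘ f₁⁻¹ between the two images,
which fixes N, would witness splitting. -/
theorem nonSplit_of_not_splits {p : K.GaS M} {N : L.Substructure M} (hN : K.Strong N)
    (h : ¬ p.Splits μ N) : NonSplit μ (Emb.incl hN) p := by
  intro X _ f₁ f₂ g hX h₁ h₂
  by_contra hne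
  let e₁ := f₁.toEmbedding.equivRange
  let e₂ := f₂.toEmbedding.equivRange
  have hN₁ : N ≤ f₁.range := fun x hx => Emb.mem_range.2 ⟨g ⟨x, hx⟩, h₁ _⟩
  have hN₂ : N ≤ f₂.range := fun x hx => Emb.mem_range.2 ⟨g ⟨x, hx⟩, h₂ _⟩
  refine h ⟨f₁.range, f₂.range, f₁.strong, f₂.strong, e₂.comp e₁.symm,
    f₁.mk_card_range.trans hX, f₂.mk_card_range.trans hX, strongIn_of_le hN f₁.strong hN₁,
    strongIn_of_le hN f₂.strong hN₂, fun x hx => ?_, fun heq => hne ?_⟩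
  · have hx' : x = e₁ (g ⟨x, hx⟩) := Subtype.ext (h₁ ⟨x, hx⟩).symm
    have h3 : e₁.symm x = g ⟨x, hx⟩ := by
      conv_lhs => rw [hx']
      exact e₁.symm_apply_apply _
    change (e₂ (e₁.symm x) : M) = x
    rw [h3]
    exact h₂ ⟨x, hx⟩
  · have hm₂ := (K.mem_of_strong f₂.strong).1
    have h3 := congrArg (GaS.comap (Emb.ofEquiv hm₂ e₂)) heq
    unfold GaS.map GaS.restrict at h3
    rw [GaS.comap_comap, GaS.comap_comap, GaS.comap_comap] at h3
    refine Eq.trans (congrArg (fun f => p.comap f) ?_) h3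
    refine Emb.ext fun x => ?_
    change f₁ x = ((e₂.comp e₁.symm).symm (e₂ x) : M)
    have : e₂ x = (e₂.comp e₁.symm) (e₁ x) := by
      change e₂ x = e₂ (e₁.symm (e₁ x))
      rw [FirstOrder.Language.Equiv.symm_apply_apply]
    rw [this, FirstOrder.Language.Equiv.symm_apply_apply]
    rfl

theorem NonSplit.comap {a : K.Emb A M} {p : K.GaS M} (h : NonSplit μ a p) (f : K.Emb D M)
    (a' : K.Emb A D) (ha : ∀ x, f (a' x) = a x) : NonSplit μ a' (p.comap f) := by
  intro X _ f₁ f₂ g hX h₁ h₂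
  rw [GaS.comap_comap, GaS.comap_comap]
  exact h X _ _ g hX (fun x => by rw [Emb.comp_apply, h₁, ha])
    (fun x => by rw [Emb.comp_apply, h₂, ha])

/-- Uniqueness of non-splitting extensions. -/
theorem NonSplit.unique {a : K.Emb A B}
    (hu : ∀ (D : Type u) [L.Structure D] (d : K.Emb A D), #D = μ →
      ∃ h : K.Emb D B, ∀ x, h (d x) = a x)
    (hD : #D = μ) (e : K.Emb B D) {p q : K.GaS D} (hp : NonSplit μ (e.comp a) p)
    (hq : NonSplit μ (e.comp a) q) (hpq : p.comap e = q.comap e) : p = q := by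
  -- Fold D into B over A. Non-splitting, applied to the identity of D and to the folding map, shows
  -- that a type over D is determined by its restriction to B.
  obtain ⟨h, hh⟩ := hu D (e.comp a) hD
  have key : ∀ r : K.GaS D, NonSplit μ (e.comp a) r → r = (r.comap e).comap h := by
    intro r hr
    have h1 := hr D (Emb.refl e.mem_cod) (e.comp h) (e.comp a) hD (fun _ => rfl)
      (fun x => by rw [Emb.comp_apply, hh, Emb.comp_apply])
    rwa [GaS.comap_refl, ← GaS.comap_comap] at h1
  rw [key p hp, key q hq, hpq]

/-- Existence of non-splitting extensions. -/
theorem NonSplit.exists_extension {a : K.Emb A B}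
    (hu : ∀ (D : Type u) [L.Structure D] (d : K.Emb A D), #D = μ →
      ∃ h : K.Emb D B, ∀ x, h (d x) = a x)
    (hB : #B = μ) (hD : #D = μ) (e : K.Emb B D) {p : K.GaS B} (hp : NonSplit μ a p) :
    ∃ q : K.GaS D, NonSplit μ (e.comp a) q ∧ q.comap e = p := by
  obtain ⟨h, hh⟩ := hu D (e.comp a) hD
  refine ⟨p.comap h, hp.comap h _ hh, ?_⟩
  -- The folding map need not be the identity on B, but p cannot distinguish the two since both
  -- agree on A.
  have h1 := hp B (h.comp e) (Emb.refl e.mem_dom) a hB hh (fun _ => rfl)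
  rw [GaS.comap_comap, h1, GaS.comap_refl]

end NonSplitting

/-! ### Realizing non-splitting types in saturated models -/

/-- If all limit models of cardinality `μ⁺` are isomorphic, then a `μ⁺`-saturated model containing
`B` realizes every type over a model `C` containing `B` which does not `μ`-split over a model `A`
over which `B` is universal. -/
theorem exists_realization_of_nonSplit (hAP : K.Amalgamation) (hLS : K.LS ≤ μ) (hst : K.Stable μ)
    (hst' : K.Stable (Order.succ μ)) (huniq : K.UniqueLimitModel (Order.succ μ))
    {A B C M₀ M : Type u} [L.Structure A] [L.Structure B] [L.Structure C] [L.Structure M₀]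
    [L.Structure M] {a : K.Emb A B}
    (hu : ∀ (D : Type u) [L.Structure D] (d : K.Emb A D), #D = μ →
      ∃ h : K.Emb D B, ∀ x, h (d x) = a x)
    (hB : #B = μ) (hC : #C = μ) (b : K.Emb B C) {p : K.GaS C} (hp : NonSplit μ (b.comp a) p)
    (hM₀ : K.Saturated (Order.succ μ) M₀) (hM₀c : Order.succ μ ≤ #M₀) (j : K.Emb B M₀)
    (m : K.Emb M₀ M) (c : K.Emb C M) (hcm : ∀ x, c (b x) = m (j x)) :
    ∃ x : M₀, galoisType c (m x) = p := by
  by_contra! hno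
  have hμ := aleph0_le_of_LS_le hLS
  have hLS' := hLS.trans (Order.le_succ μ)
  have hlam := aleph0_le_of_LS_le hLS'
  have hCl : #C ≤ Order.succ μ := hC.le.trans (Order.le_succ μ)
  have hpB : NonSplit μ a (p.comap b) := hp.comap b a fun _ => rfl
  -- This merely supplies a model of size μ⁺ into which B embeds; its position in `M₀` plays no role
  -- later.
  obtain ⟨X₀₀, hX₀₀, hsub, hX₀₀c⟩ := exists_strong_eq hLS' j.mem_cod hM₀c (j.range : Set M₀)
    (j.mk_card_range.le.trans (hB.le.trans (Order.le_succ μ)))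
  obtain ⟨jB, -⟩ := Emb.lift (Emb.incl hX₀₀) j
    fun x => ⟨⟨j x, hsub (Emb.mem_range.2 ⟨x, rfl⟩)⟩, rfl⟩
  obtain ⟨E, _, ι, hE⟩ := exists_saturated_extension hAP hLS' hst' jB.mem_cod hX₀₀c
  let j₀ := ι.comp jB
  have hX₀c : #ι.range = Order.succ μ := ι.mk_card_range.trans hX₀₀c
  obtain ⟨S, hS0, hS, hm, hQ, hcont⟩ := exists_substructure_chain hlam ι.range ι.strong hX₀c
    Ordinal.omega0 (by simpa using hlam)
    (fun _ X Y => UniversalWithin K X Y ∧ ∃ c' : K.Emb C E, (∀ z, c' z ∈ Y) ∧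
      (∀ z, c' (b z) = j₀ z) ∧ ∀ x ∈ X, galoisType c' x ≠ p)
    (by
      intro _ X hX hXc hX₀
      obtain ⟨jX, hjX⟩ := Emb.lift (Emb.incl hX) j₀
        fun z => ⟨⟨j₀ z, hX₀ (Emb.mem_range.2 ⟨jB z, rfl⟩)⟩, rfl⟩
      -- X is placed in `M₀` over B, where p is omitted. A model V of size μ⁺ containing X and C is
      -- then brought back into E over X.
      obtain ⟨k, hk⟩ := hM₀.exists_emb_succ hAP hLS hst j jX hB hXc.le
      obtain ⟨V, _, v, k', c'', hV, hk', hc''⟩ :=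
        exists_small_codomain hLS' (m.comp k) c hXc.le hCl
      have hVc : #V = Order.succ μ :=
        le_antisymm hV (hXc.ge.trans (Cardinal.mk_le_of_injective k'.injective))
      obtain ⟨h, hh⟩ := hE.exists_emb hAP hLS' hst' (Emb.incl hX) k' hXc hVc
      obtain ⟨Y, hle, hY, hYu, -⟩ := exists_universalWithin hAP hLS' hst' hE h.range h.strong
        (h.mk_card_range.trans hVc)
      have hXh : X ≤ h.range := fun x hx => Emb.mem_range.2 ⟨k' ⟨x, hx⟩, hh _⟩
      refine ⟨Y, hXh.trans hle, hY, hYu.mono_left hAP hLS' hX h.strong hXh hXc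
        (h.mk_card_range.trans hVc), h.comp c'', fun z => hle (Emb.mem_range.2 ⟨_, rfl⟩),
        fun z => ?_, fun x hx => ?_⟩
      · have h1 : c'' (b z) = k' (jX z) :=
          v.injective (by rw [hc'', hk', hcm, Emb.comp_apply, hk])
        rw [Emb.comp_apply, h1, hh, hjX]
      · have h1 : galoisType (h.comp c'') x = galoisType c (m (k ⟨x, hx⟩)) := by
          have h2 : x = h (k' ⟨x, hx⟩) := (hh ⟨x, hx⟩).symm
          have h3 : c = v.comp c'' := Emb.ext fun z => (hc'' z).symm
          conv_lhs => rw [h2]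
          rw [galoisType_comp, h3, ← Emb.comp_apply m k, ← hk', galoisType_comp]
        rw [h1]
        exact hno _)
  have hl : Order.IsSuccLimit Ordinal.omega0.{u} := Ordinal.isSuccLimit_omega0
  have hpos := isSuccLimit_pos hl
  obtain ⟨N', -, hN', -, hN'l, hN's⟩ := exists_universal_chain hAP hLS' hst' hE ι.range ι.strong
    hX₀c
  have hN := (hS _ le_rfl).1
  have hSN : ∀ i < Ordinal.omega0, S i ≤ S Ordinal.omega0 := fun i hi => hm i _ hi.le le_rfl
  have hlim : LimitWithin K (Order.succ μ) Ordinal.omega0 (S Ordinal.omega0) :=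
    ⟨S, fun i hi => hS i hi.le, fun i j hij hj => hm i j hij hj.le, fun i hi => hcont i hi.le,
      fun i hi => (hQ i ((Order.le_succ i).trans_lt hi)).1,
      fun x => ⟨hcont _ le_rfl hl x, fun ⟨i, hi, hx⟩ => hSN i hi hx⟩⟩
  have hrange : ∀ {N : L.Substructure E} (hN : K.Strong N) (y : E),
      y ∈ N ↔ ∃ x, Emb.incl hN x = y :=
    fun hN y => ⟨fun hy => ⟨⟨y, hy⟩, rfl⟩, fun ⟨x, hx⟩ => hx ▸ x.2⟩
  have hlt : Ordinal.omega0.{u} < (Order.succ (Order.succ μ)).ord := by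
    rw [Cardinal.lt_ord, Ordinal.card_omega0]
    exact hlam.trans_lt (Order.lt_succ _)
  -- The limit model `N'` of length μ⁺ is saturated because μ⁺ is regular; uniqueness transfers
  -- saturation to the union of length ω.
  obtain ⟨e⟩ := huniq N' (S Ordinal.omega0) (hN'l.isLimitModel hlam (Emb.incl hN'.1)
    (hrange hN'.1)) ⟨_, hl, hlt, hlim.isLimit (Emb.incl hN) (hrange hN)⟩
  have hsat : K.Saturated (Order.succ μ) (S Ordinal.omega0) :=
    (hN's (Cardinal.isRegular_succ hμ)).of_surjective
      (Emb.ofEquiv (K.mem_of_strong hN).1 e) e.surjective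
  have hQ' : ∀ i, ∃ c' : K.Emb C E, i < Ordinal.omega0 → (∀ z, c' z ∈ S Ordinal.omega0) ∧
      (∀ z, c' (b z) = j₀ z) ∧ ∀ x ∈ S i, galoisType c' x ≠ p := by
    intro i
    by_cases hi : i < Ordinal.omega0
    · obtain ⟨-, c', h1, h2, h3⟩ := hQ i hi
      exact ⟨c', fun _ => ⟨fun z => hSN _ (hl.succ_lt hi) (h1 z), h2, h3⟩⟩
    · obtain ⟨-, c', -⟩ := hQ 0 hpos
      exact ⟨c', fun h => absurd h hi⟩
  choose c' hc' using hQ'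
  obtain ⟨D, hD, hDsub, hDc⟩ := exists_strong_eq hLS hsat.1
    ((Order.le_succ μ).trans (hS _ le_rfl).2.ge)
    {x | ∃ i < Ordinal.omega0, (x : E) ∈ Set.range (c' i)} (by
      refine mk_biUnion_ordinal_le hμ (δ := Ordinal.omega0) (by simpa using hμ)
        (fun i => {x : S Ordinal.omega0 | (x : E) ∈ Set.range (c' i)}) (fun i _ => ?_) _ (fun x hx => hx)
      refine (Cardinal.mk_preimage_of_injective _ _ Subtype.val_injective).trans ?_
      exact Cardinal.mk_range_le.trans hC.le)
  let δ := (Emb.incl hN).comp (Emb.incl hD)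
  have hlift : ∀ i, ∃ cD : K.Emb C D, i < Ordinal.omega0 → ∀ z, δ (cD z) = c' i z := by
    have key : ∀ i < Ordinal.omega0, ∃ cD : K.Emb C D, ∀ z, δ (cD z) = c' i z := fun i hi =>
      Emb.lift δ (c' i) fun z => ⟨⟨⟨c' i z, (hc' i hi).1 z⟩, hDsub ⟨i, hi, z, rfl⟩⟩, rfl⟩
    intro i
    by_cases hi : i < Ordinal.omega0
    · obtain ⟨f, hf⟩ := key i hi
      exact ⟨f, fun _ => hf⟩
    · obtain ⟨f, -⟩ := key 0 hpos
      exact ⟨f, fun h => absurd h hi⟩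
  choose cD hcD using hlift
  have hcDb : ∀ i < Ordinal.omega0, (cD i).comp b = (cD 0).comp b := by
    intro i hi
    refine Emb.ext fun z => δ.injective ?_
    change δ (cD i (b z)) = δ (cD 0 (b z))
    rw [hcD i hi, hcD 0 hpos, (hc' i hi).2.1,
      (hc' 0 hpos).2.1]
  -- All the copies of C agree on B, so a single q over D extends p ↾ B through each of them.
  obtain ⟨q, hq, hqb⟩ := hpB.exists_extension hu hB hDc ((cD 0).comp b)
  obtain ⟨x, hx⟩ := hsat.2 D hD (hDc ▸ Order.lt_succ μ) q
  obtain ⟨i, hi, hxi⟩ := hcont _ le_rfl hl x x.2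
  refine (hc' i hi).2.2 x hxi ?_
  -- Both types are non-splitting over A and agree on B, which is universal over A.
  have h1 : q.comap (cD i) = p := by
    refine NonSplit.unique hu hC b (hq.comap (cD i) (b.comp a) fun z => ?_) hp ?_
    · rw [← hcDb i hi]
      rfl
    · rw [GaS.comap_comap, hcDb i hi, hqb]
  rw [← h1, ← hx, comap_galoisType, ← galoisType_comp (Emb.incl hN)]
  congr 1
  exact Emb.ext fun z => (hcD i hi z).symm

/-! ### Limit models inside the members of a chain -/

section Unions

variable {M X : Type u} [L.Structure M] [L.Structure X]

theorem UniversalWithin.map (f : K.Emb X M) {S T : L.Substructure X} (hS : K.Strong S)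
    (h : UniversalWithin K S T) :
    UniversalWithin K (S.map f.toEmbedding.toHom) (T.map f.toEmbedding.toHom) := by
  intro D _ d hD
  obtain ⟨k, hk⟩ := Emb.lift (Emb.incl (f.strong_map hS)) (f.comp (Emb.incl hS))
    fun x => ⟨⟨f x, Substructure.mem_map_of_mem _ x.2⟩, rfl⟩
  have hks : Function.Surjective k := by
    rintro ⟨y, hy⟩
    obtain ⟨x, hx, rfl⟩ := Substructure.mem_map.1 hy
    exact ⟨⟨x, hx⟩, Subtype.ext (hk _)⟩
  obtain ⟨e, he, he'⟩ := h D (d.comp k)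
    (hD.trans (Cardinal.mk_congr (Equiv.ofBijective k ⟨k.injective, hks⟩)).symm)
  refine ⟨f.comp e, fun y => Substructure.mem_map_of_mem _ (he y), fun x => ?_⟩
  obtain ⟨z, rfl⟩ := hks x
  have := he' z
  rw [Emb.comp_apply] at this
  rw [Emb.comp_apply, this]
  exact (hk z).symm

/-- Limit models inside a saturated strong substructure `V` of `M`, universal over all small models
contained in a given set. -/
theorem exists_limit_within (hAP : K.Amalgamation) (hLS : K.LS ≤ μ) (hst : K.Stable μ)
    {V : L.Substructure M} (hV : K.Strong V) (hVs : K.Saturated (Order.succ μ) V)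
    (hVc : Order.succ μ ≤ #V) (A : Set M) (hA : #A ≤ μ) (hAV : A ⊆ V) :
    ∃ Y : L.Substructure M, A ⊆ Y ∧ Y ≤ V ∧ K.Strong Y ∧ #Y = μ ∧
      (∀ (Z : Type u) [L.Structure Z] (g : K.Emb Z M), (∀ y, y ∈ Y ↔ ∃ z, g z = y) →
        K.IsLimitModel μ Z) ∧
      ∀ T : L.Substructure M, K.Strong T → #T = μ → (T : Set M) ⊆ A → UniversalWithin K T Y := by
  have hμ := aleph0_le_of_LS_le hLS
  obtain ⟨S, hS, hsub, hSc⟩ := exists_strong_eq hLS hVs.1 ((Order.le_succ μ).trans hVc)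
    (Subtype.val ⁻¹' A : Set V)
    ((Cardinal.mk_preimage_of_injective _ _ Subtype.val_injective).trans hA)
  obtain ⟨N, hSN, hN, hu, hlim, -⟩ := exists_universal_chain hAP hLS hst hVs S hS hSc
  let f := Emb.incl hV
  have hmk : ∀ T : L.Substructure V, #(T.map f.toEmbedding.toHom) = #T := by
    intro T
    refine (Cardinal.mk_congr (Equiv.ofBijective
      (fun x : T => (⟨f x, Substructure.mem_map_of_mem _ x.2⟩ : T.map f.toEmbedding.toHom))
      ⟨fun x y hxy => ?_, ?_⟩)).symm
    · exact Subtype.ext (f.injective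
        (congrArg (fun t : T.map f.toEmbedding.toHom => (t : M)) hxy))
    · rintro ⟨y, hy⟩
      obtain ⟨x, hx, rfl⟩ := Substructure.mem_map.1 hy
      exact ⟨⟨x, hx⟩, rfl⟩
  have hAS : ∀ x ∈ A, x ∈ S.map f.toEmbedding.toHom := fun x hx =>
    Substructure.mem_map.2 ⟨⟨x, hAV hx⟩, hsub hx, rfl⟩
  have hNV : ∀ x ∈ N.map f.toEmbedding.toHom, x ∈ V := by
    intro x hx
    obtain ⟨y, -, rfl⟩ := Substructure.mem_map.1 hx
    exact y.2
  refine ⟨N.map f.toEmbedding.toHom, fun x hx => Substructure.monotone_map hSN (hAS x hx), hNV,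
    f.strong_map hN.1, (hmk N).trans hN.2, fun Z _ g hg => ?_, fun T hT hTc hTA => ?_⟩
  · obtain ⟨k, hk⟩ := Emb.lift f g fun z => ⟨⟨g z, hNV _ ((hg _).2 ⟨z, rfl⟩)⟩, rfl⟩
    refine hlim.isLimitModel hμ k fun y => ⟨fun hy => ?_, ?_⟩
    · obtain ⟨z, hz⟩ := (hg _).1 (Substructure.mem_map_of_mem f.toEmbedding.toHom hy)
      exact ⟨z, f.injective ((hk z).trans hz)⟩
    · rintro ⟨z, rfl⟩
      obtain ⟨y, hy, hyz⟩ := Substructure.mem_map.1 ((hg _).2 ⟨z, rfl⟩)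
      have : k z = y := f.injective ((hk z).trans hyz.symm)
      rwa [this]
  · exact (hu.map f hS).mono_left hAP hLS hT (f.strong_map hS) (fun x hx => hAS x (hTA hx)) hTc
      ((hmk S).trans hSc)

theorem Saturated.exists_realization {κ : Cardinal.{u}} (hM : K.Saturated κ M) (f : K.Emb X M)
    (hX : #X < κ) (p : K.GaS X) : ∃ a : M, galoisType f a = p := by
  obtain ⟨k, hk⟩ := Emb.lift f (Emb.incl f.strong) fun y => Emb.mem_range.1 y.2
  obtain ⟨k', hk'⟩ := Emb.lift (Emb.incl f.strong) f
    fun x => ⟨⟨f x, Emb.mem_range.2 ⟨x, rfl⟩⟩, rfl⟩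
  obtain ⟨a, ha⟩ := hM.2 f.range f.strong (f.mk_card_range.trans_lt hX) (p.comap k)
  refine ⟨a, ?_⟩
  have h1 : (p.comap k).comap k' = p := by
    rw [GaS.comap_comap]
    have : k.comp k' = Emb.refl f.mem_dom := Emb.ext fun x => f.injective (by
      rw [Emb.comp_apply, hk, hk', Emb.refl_apply])
    rw [this, GaS.comap_refl]
  rw [← h1, ← ha, comap_galoisType]
  congr 1
  exact Emb.ext fun x => (hk' x).symm

/-- Members of an increasing chain of models are strong in the union of the chain. -/
theorem strong_union {θ : Ordinal.{u}} (hθ : 0 < θ) (S : Ordinal.{u} → L.Substructure M)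
    (hmem : ∀ i < θ, K.Mem (S i)) (hS : ∀ i j, i ≤ j → j < θ → K.StrongIn (S i) (S j))
    (hU : ∀ x : M, ∃ i < θ, x ∈ S i) : K.Mem M ∧ ∀ i < θ, K.Strong (S i) := by
  rcases Ordinal.zero_or_succ_or_isSuccLimit θ with rfl | ⟨k, rfl⟩ | hl
  · exact absurd hθ (lt_irrefl 0)
  · have hk : k < Order.succ k := Order.lt_succ k
    -- At successor length the last member is already the whole structure.
    have htop : S k = ⊤ := by
      refine eq_top_iff.2 fun x _ => ?_
      obtain ⟨i, hi, hx⟩ := hU x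
      exact (hS i k (Order.lt_succ_iff.1 hi) hk).1 hx
    have hM : K.Mem M := K.mem_equiv (Substructure.topEquiv (L := L)) (htop ▸ hmem k hk)
    refine ⟨hM, fun i hi => strong_of_strongIn ?_ (hS i k (Order.lt_succ_iff.1 hi) hk)⟩
    rw [htop]
    exact K.strong_top hM
  · exact K.union_chain θ hl S hS hU

end Unions

end AEC

/-! ### The union theorem -/

open AEC in
theorem mainTheorem3 {L : FirstOrder.Language.{u, u}} (K : AEC L) (μ : Cardinal.{u}) (hμ : K.LS ≤ μ)
    (hAP : K.Amalgamation) (hJEP : K.JointEmbedding) (hmax : K.NoMaximal (Order.succ μ))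
    (hss : K.Superstable μ) (hss' : K.Superstable (Order.succ μ))
    (huniq : K.UniqueLimitModel (Order.succ μ))
    (θ : Ordinal.{u}) (hθ : 0 < θ)
    (U : Type u) [L.Structure U] (M : Ordinal.{u} → L.Substructure U)
    (hcard : ∀ i < θ, Order.succ μ ≤ #(M i))
    (hinc : ∀ i j, i ≤ j → j < θ → K.StrongIn (M i) (M j))
    (hsat : ∀ i < θ, K.Saturated (Order.succ μ) (M i))
    (hlen : θ < (Order.succ (⨆ i : Set.Iio θ, #(M i))).ord)
    (hU : ∀ x : U, ∃ i < θ, x ∈ M i) :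
    K.Saturated (Order.succ μ) U := by
  have hℵ := aleph0_le_of_LS_le hμ
  obtain ⟨hUmem, hM⟩ := strong_union hθ M (fun i hi => (hsat i hi).1) hinc hU
  refine ⟨hUmem, fun S hS hSc p => ?_⟩
  have hSμ : #S ≤ μ := Order.lt_succ_iff.1 hSc
  by_cases hex : ∃ i < θ, S ≤ M i
  · obtain ⟨i, hi, hSi⟩ := hex
    obtain ⟨a, rfl⟩ := (hsat i hi).exists_realization (inclLE hS (hM i hi) hSi) hSc p
    refine ⟨a, ?_⟩
    rw [← galoisType_comp (Emb.incl (hM i hi))]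
    congr 1
    exact Emb.ext fun x => by simp
  -- If the cofinality exceeded μ, the indices at which the elements of S appear would be bounded,
  -- and S would lie in one member.
  have hcof : θ.cof ≤ μ := by
    by_contra! h
    choose r hr using fun x : S => hU x
    have hlt : iSup r < θ :=
      Ordinal.iSup_lt_of_lt_cof (hSμ.trans_lt h) fun x => (hr x).1
    exact hex ⟨_, hlt, fun x hx => (hinc _ _ (Ordinal.le_iSup r ⟨x, hx⟩) hlt).1 (hr ⟨x, hx⟩).2⟩
  have hlim : Order.IsSuccLimit θ := by
    rcases Ordinal.zero_or_succ_or_isSuccLimit θ with rfl | ⟨k, rfl⟩ | hl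
    · exact absurd hθ (lt_irrefl 0)
    · refine absurd ⟨k, Order.lt_succ k, fun x _ => ?_⟩ hex
      obtain ⟨i, hi, hx⟩ := hU x
      exact (hinc i k (Order.lt_succ_iff.1 hi) (Order.lt_succ k)).1 hx
    · exact hl
  have hαℵ : ℵ₀ ≤ θ.cof := Ordinal.aleph0_le_cof_iff.2 (Ordinal.one_lt_cof_iff.2 hlim)
  obtain ⟨α, hα⟩ : ∃ α, θ.cof.ord = α := ⟨_, rfl⟩
  obtain ⟨t, ht⟩ := Ordinal.exists_isFundamentalSeq hα
  have hαl : Order.IsSuccLimit α := hα ▸ Cardinal.isSuccLimit_ord hαℵ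
  have hαpos := isSuccLimit_pos hαl
  have hαc : ∀ i ≤ α, i.card ≤ μ := fun i hi =>
    (card_le_of_le_ord (hi.trans hα.ge)).trans hcof
  have hMm : ∀ i (hi : i < α) j (hj : j < α), i ≤ j → M (t ⟨i, hi⟩) ≤ M (t ⟨j, hj⟩) :=
    fun i hi j hj hij => (hinc _ _ (ht.strictMono.monotone hij) (t ⟨j, hj⟩).2).1
  have hSsmall : ∀ V : L.Substructure U, #((S : Set U) ∩ V : Set U) ≤ μ := fun V =>
    (Cardinal.mk_le_mk_of_subset Set.inter_subset_left).trans hSμ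
  have build : ∀ i (hi : i < α) (A : Set U), #A ≤ μ → A ⊆ M (t ⟨i, hi⟩) →
      ∃ Y : L.Substructure U, ((S : Set U) ∩ M (t ⟨i, hi⟩)) ∪ A ⊆ Y ∧ Y ≤ M (t ⟨i, hi⟩) ∧
      K.Strong Y ∧ #Y = μ ∧
      (∀ (Z : Type u) [L.Structure Z] (g : K.Emb Z U), (∀ y, y ∈ Y ↔ ∃ z, g z = y) →
        K.IsLimitModel μ Z) ∧ ∀ T : L.Substructure U, K.Strong T → #T = μ →
          (T : Set U) ⊆ ((S : Set U) ∩ M (t ⟨i, hi⟩)) ∪ A → UniversalWithin K T Y :=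
    fun i hi A hA hAM => exists_limit_within hAP hμ hss.1 (hM _ (t ⟨i, hi⟩).2)
      (hsat _ (t ⟨i, hi⟩).2) (hcard _ (t ⟨i, hi⟩).2) _
      ((Cardinal.mk_union_le _ _).trans (Cardinal.add_le_of_le hℵ (hSsmall _) hA))
      (Set.union_subset Set.inter_subset_right hAM)
  obtain ⟨Y₀, hY₀A, hY₀M, hY₀, hY₀c, hY₀l, -⟩ := build 0 hαpos ∅ (by simp) (by simp)
  -- The empty set in place of the carriers makes the continuity clause void. At limits the chain
  -- must jump past the union in order to absorb `S ∩ M (t i)` and to remain a limit model;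
  -- superstability does not ask for continuity.
  obtain ⟨N, -, hN, hNm, hNu, -⟩ := exists_chain (P := L.Substructure U)
    (fun _ => (∅ : Set PEmpty.{u + 1})) α
    (fun i Y => ∀ hi : i < α, (S : Set U) ∩ M (t ⟨i, hi⟩) ⊆ Y ∧ Y ≤ M (t ⟨i, hi⟩) ∧
      K.Strong Y ∧ #Y = μ ∧ ∀ (Z : Type u) [L.Structure Z] (g : K.Emb Z U),
        (∀ y, y ∈ Y ↔ ∃ z, g z = y) → K.IsLimitModel μ Z)
    (fun _ Y Y' => UniversalWithin K Y Y') Y₀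
    (fun _ => ⟨Set.subset_union_left.trans hY₀A, hY₀M, hY₀, hY₀c, hY₀l⟩)
    (by
      intro i hi Y _ hY
      obtain ⟨-, hYM, hYs, hYc, -⟩ := hY hi
      have hi' := hαl.succ_lt hi
      obtain ⟨Y', h1, h2, h3, h4, h5, h6⟩ := build _ hi' (Y : Set U) hYc.le
        (hYM.trans (hMm _ _ _ _ (Order.le_succ i)))
      exact ⟨Y', fun x hx => h1 (Or.inr hx),
        fun _ => ⟨Set.subset_union_left.trans h1, h2, h3, h4, h5⟩,
        h6 Y hYs hYc Set.subset_union_right⟩)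
    (by
      intro i hi hl f _ hf hY
      rcases hi.eq_or_lt with rfl | hi'
      -- Stage α carries no requirement; the true union C is formed separately below.
      · exact ⟨⊤, fun h => absurd h (lt_irrefl _), fun _ _ => le_top, fun x hx => absurd hx.elim id⟩
      obtain ⟨V, hV⟩ := exists_substructure_union (isSuccLimit_pos hl) f hf
      obtain ⟨Y', h1, h2, h3, h4, h5, -⟩ := build i hi' (V : Set U)
        (mk_biUnion_ordinal_le hℵ (hαc i hi) (fun j => (f j : Set U))
          (fun j hj => (hY j hj (hj.trans hi')).2.2.2.1.le) _ (fun x hx => (hV x).1 hx)) (by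
          intro x hx
          obtain ⟨j, hj, hxj⟩ := (hV x).1 hx
          exact hMm _ _ _ _ hj.le ((hY j hj (hj.trans hi')).2.1 hxj))
      exact ⟨Y', fun _ => ⟨Set.subset_union_left.trans h1, h2, h3, h4, h5⟩,
        fun j hj x hx => h1 (Or.inr ((hV x).2 ⟨j, hj, hx⟩)), fun x hx => absurd hx.elim id⟩)
  have hN' := fun i (hi : i < α) => hN i hi.le hi
  obtain ⟨C, hC⟩ := exists_substructure_union hαpos N fun i j hij hj => hNm i j hij hj.le
  have hNC : ∀ i < α, N i ≤ C := fun i hi x hx => (hC x).2 ⟨i, hi, hx⟩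
  have hCs : K.Strong C := K.union_strong α hαl N C (fun i j hij hj => hNm i j hij hj.le)
    (fun i hi => (hN' i hi).2.2.1) hC
  have hCc : #C = μ := by
    apply le_antisymm
    · exact mk_biUnion_ordinal_le hℵ (hαc α le_rfl) (fun j => (N j : Set U))
        (fun j hj => (hN' j hj).2.2.2.1.le) _ (fun x hx => (hC x).1 hx)
    · rw [← (hN' 0 hαpos).2.2.2.1]
      exact Cardinal.mk_le_mk_of_subset (hNC 0 hαpos)
  have hSC : S ≤ C := by
    intro x hx
    obtain ⟨k, hk, hxk⟩ := hU x
    obtain ⟨_, ⟨⟨i, hi⟩, rfl⟩, hki⟩ := ht.isCofinal_range ⟨k, hk⟩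
    exact (hC x).2 ⟨i, hi, (hN' i hi).1 ⟨hx, (hinc _ _ hki (t ⟨i, hi⟩).2).1 hxk⟩⟩
  obtain ⟨p', rfl⟩ := p.exists_extension hAP (inclLE hS hCs hSC)
  suffices h : ∃ a : U, galoisType (Emb.incl hCs) a = p' by
    obtain ⟨a, rfl⟩ := h
    refine ⟨a, ?_⟩
    rw [comap_galoisType]
    congr 1
    exact Emb.ext fun x => by simp
  let f := Emb.incl hCs
  have hf : ∀ i < α, ∀ y ∈ N i, ∃ x, f x = y := fun i hi y hy => ⟨⟨y, hNC i hi hy⟩, rfl⟩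
  let N' : Ordinal.{u} → L.Substructure C := fun i => (N i).comap f.toEmbedding.toHom
  have hNs : ∀ i < α, K.Strong (N' i) := fun i hi => f.strong_comap (hN' i hi).2.2.1 (hf i hi)
  obtain ⟨i, hi, hns⟩ := hss.2 α (by rw [← hα]; exact Cardinal.omega0_le_ord.2 hαℵ) C N'
    (fun i hi => (hN' i hi).2.2.2.2 _ (f.comp (Emb.incl (hNs i hi))) fun y =>
      ⟨fun hy => ⟨⟨⟨y, hNC i hi hy⟩, hy⟩, rfl⟩, by
        rintro ⟨z, rfl⟩
        exact z.2⟩)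
    (fun i j hij hj => f.strongIn_comap (hN' i (hij.trans_lt hj)).2.2.1 (hN' j hj).2.2.1
      (hNm i j hij hj.le) (hf j hj))
    (fun i hi => by
      have hi' := (Order.le_succ i).trans_lt hi
      exact f.universalIn_comap (hN' i hi').2.2.1 (hN' _ hi).2.2.1
        (hNm _ _ (Order.le_succ i) hi.le) (hf _ hi) (hNu i hi'))
    (fun x => (hC x).1 x.2) p'
  have hi' := hαl.succ_lt hi
  obtain ⟨-, hBM, hB, hBc, -⟩ := hN' _ hi'
  let b := inclLE hB hCs (hNC _ hi')
  obtain ⟨a, ha⟩ := Emb.lift b (Emb.incl (hNs i hi)) fun x =>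
    ⟨⟨x, hNm _ _ (Order.le_succ i) hi'.le x.2⟩, Subtype.ext (coe_inclLE _ _ _ _)⟩
  have hp : NonSplit μ (b.comp a) p' := by
    have : b.comp a = Emb.incl (hNs i hi) := Emb.ext ha
    rw [this]
    exact nonSplit_of_not_splits _ hns
  have haU : ∀ x, (a x : U) = f x := fun x => by
    rw [← coe_inclLE hB hCs (hNC _ hi') (a x)]
    exact congrArg Subtype.val (ha x)
  -- Here A and B are `N i` and `N (i + 1)`, and the saturated model is the member of the original
  -- chain containing B. Universality was recorded for `N i` inside U, so it is transferred to its
  -- copy inside C.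
  obtain ⟨x, hx⟩ := exists_realization_of_nonSplit hAP hμ hss.1 hss'.1 huniq
    (fun D _ d hD => by
      obtain ⟨k, hk⟩ := Emb.lift (f.comp (Emb.incl (hNs i hi))) (Emb.incl (hN' i hi).2.2.1)
        fun y => ⟨⟨⟨y, hNC i hi y.2⟩, y.2⟩, rfl⟩
      obtain ⟨e, he, he'⟩ := hNu i hi D (d.comp k) (hD.trans (hN' i hi).2.2.2.1.symm)
      obtain ⟨w, hw⟩ := Emb.lift (Emb.incl hB) e fun y => ⟨⟨e y, he y⟩, rfl⟩
      refine ⟨w, fun x => Subtype.ext ((hw _).trans ?_)⟩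
      have h1 : k ⟨f x, x.2⟩ = x := (f.comp (Emb.incl (hNs i hi))).injective (hk _)
      have h2 := he' ⟨f x, x.2⟩
      rw [Emb.comp_apply, h1] at h2
      rw [h2, haU])
    hBc hCc b hp (hsat _ (t ⟨_, hi'⟩).2) (hcard _ (t ⟨_, hi'⟩).2)
    (inclLE hB (hM _ (t ⟨_, hi'⟩).2) hBM) (Emb.incl (hM _ (t ⟨_, hi'⟩).2)) (Emb.incl hCs)
    (fun x => by simp [b])
  exact ⟨_, hx⟩
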